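/- \textbf{Setting.} Let $V$ be a $7$-dimensional vector space over $\mathbb{F}\in\{\mathbb{R},\mathbb{C}\}$. For a basis $e_1,\dots,e_7$ with dual basis $e^1,\dots,e^7$ write $e^{i_1\cdots i_k}=e^{i_1}\wedge\cdots\wedge e^{i_k}$. For $\varepsilon\in\{1,-1\}$ put $$\varphi_\varepsilon=\varepsilon(e^{127}+e^{347})+e^{567}+e^{135}-e^{146}-e^{236}-e^{245}.$$ A $G_2$-structure (respectively $G_2^*$-structure) on a real $V$ is a $\varphi\in\Lambda^3V^*$ equal to $\varphi_{1}$ (respectively $\varphi_{-1}$) in some basis, called an adapted basis; it induces the volume form $\mathrm{vol}=e^{1234567}$ (independent of the adapted basis). A $(G_2)_{\mathbb{C}}$-structure on a complex $V$ is a pair $(\varphi,\mathrm{vol})\in\Lambda^3V^*\times\Lambda^7V^*$ with $\varphi=\varphi_{1}$ and $\mathrm{vol}=e^{1234567}$ in some common basis. In each case a non-degenerate symmetric bilinear form $g$ is induced by $$g(v,w)\,\mathrm{vol}=\tfrac16\,(v\lrcorner\varphi)\wedge(w\lrcorner\varphi)\wedge\varphi ,$$ and the Hodge dual $\star_\varphi\varphi\in\Lambda^4V^*$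 is defined by $\varphi\wedge\psi=g(\star_\varphi\varphi,\psi)\,\mathrm{vol}$ for all $\psi\in\Lambda^4V^*$. On a Lie algebra $\mathfrak{g}$ let $d$ be the Chevalley--Eilenberg differential on $\Lambda^*\mathfrak{g}^*$, with $d\alpha(X,Y)=-\alpha([X,Y])$ for $\alpha\in\mathfrak{g}^*$; a structure as above on $\mathfrak{g}$ is cocalibrated if $d\star_\varphi\varphi=0$. The length $l(\Omega)$ of $\Omega\in\Lambda^kU$ is the smallest $l$ such that $\Omega$ is a sum of $l$ decomposable elements $u_1\wedge\cdots\wedge u_k$ with $u_i\in U$. \textbf{Proposition.} Let $\mathfrak{g}$ be a seven-dimensional $\mathbb{F}$-Lie algebra with a six-dimensional abelian ideal $\mathfrak{u}$, let $e_7\in\mathfrak{g}\setminus\mathfrak{u}$, and let $\mathrm{Ann}\langle e_7\rangle\subseteq\mathfrak{g}^*$ be the annihilator of $e_7$ (so that $\Lambda^4\mathrm{Ann}\langle e_7\rangle\cong\Lambda^4\mathfrak{u}^*$). \begin{enumerate} \item[(a)] If $\mathbb{F}=\mathbb{R}$, the following are equivalent: (i) $\mathfrak{g}$ admits a cocalibrated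 $G_2$-structure; (ii) there is a closed $\Omega\in\Lambda^4\mathrm{Ann}\langle e_7\rangle$ with $l(\Omega)=3$; (iii) $\mathfrak{g}$ admits a cocalibrated $G_2^*$-structure such that $\mathfrak{u}$ is non-degenerate with respect to the induced pseudo-Euclidean metric $g$. \item[(b)] If $\mathbb{F}=\mathbb{R}$, $\mathfrak{g}$ admits a cocalibrated $G_2^*$-structure if and only if there is a closed $\Omega\in\Lambda^4\mathrm{Ann}\langle e_7\rangle$ with $l(\Omega)\ge2$. \item[(c)] If $\mathbb{F}=\mathbb{C}$, $\mathfrak{g}$ admits a cocalibrated $(G_2)_{\mathbb{C}}$-structure if and only if there is a closed $\Omega\in\Lambda^4\mathrm{Ann}\langle e_7\rangle$ with $l(\Omega)\ge2$; and $\mathfrak{g}$ admits a cocalibrated $(G_2)_{\mathbb{C}}$-structure such that $\mathfrak{u}$ is non-degenerate with respect to the induced symmetric bilinear form $g$ if and only if there is a closed $\Omega\in\Lambda^4\mathrm{Ann}\langle e_7\rangle$ with $l(\Omega)=3$. \end{enumerate} -/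

import Mathlib

namespace CocalibratedG2

open Module

universe u v

/-! ### Exterior forms on a vector space -/

/-- `Λᵏ V*`, as the `k`-th exterior power of the dual space. The wedge product is the product of the
ambient exterior algebra `ExteriorAlgebra F (Dual F V)`. -/
abbrev Form (F : Type u) (V : Type v) [Field F] [AddCommGroup V] [Module F V] (k : ℕ) :=
  ⋀[F]^k (Dual F V)

/-- A `k`-form as an alternating map: `(α₁ ∧ ⋯ ∧ αₖ)(v₁, …, vₖ) = det (αᵢ (vⱼ))`. -/
noncomputable def formEval {F : Type u} {V : Type v} [Field F] [AddCommGroup V] [Module F V]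
    {k : ℕ} (φ : Form F V k) : V [⋀^Fin k]→ₗ[F] F :=
  exteriorPower.alternatingMapLinearEquiv.symm (exteriorPower.pairingDual F V k φ)

/-- The contraction `v ⌟ x` of an exterior form with a vector. -/
noncomputable def hook {F : Type u} {V : Type v} [Field F] [AddCommGroup V] [Module F V]
    (v : V) (x : ExteriorAlgebra F (Dual F V)) : ExteriorAlgebra F (Dual F V) :=
  CliffordAlgebra.contractLeft (Dual.eval F V v) x

/-- The (irreducible) length of a `k`-vector `X ∈ Λᵏ M` (used for `k ≥ 1`): the smallest `l` such
that `X` is a sum of `l` decomposable `k`-vectors `v₁ ∧ ⋯ ∧ vₖ` with `v₁, …, vₖ ∈ M`. -/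
noncomputable def kLength {F : Type u} {M : Type v} [Field F] [AddCommGroup M] [Module F M]
    {k : ℕ} (X : ⋀[F]^k M) : ℕ :=
  sInf {l : ℕ | ∃ v : Fin l → Fin k → M, X = ∑ i, exteriorPower.ιMulti F k (v i)}

/-! ### The metric on forms and the Hodge dual -/

/-- The inverse `V* → V` of `v ↦ g(v, ·)` for a non-degenerate bilinear form `g` on a
finite-dimensional space (and `0` if there is no inverse). -/
noncomputable def sharp {F : Type u} {V : Type v} [Field F] [AddCommGroup V] [Module F V]
    (g : LinearMap.BilinForm F V) : Dual F V →ₗ[F] V :=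
  open Classical in
  if h : Function.Bijective (g : V →ₗ[F] Dual F V) then
    ((LinearEquiv.ofBijective (g : V →ₗ[F] Dual F V) h).symm : Dual F V →ₗ[F] V)
  else 0

/-- The bilinear form induced by `g` on `Λᵏ V*`, i.e.
`g(α₁ ∧ ⋯ ∧ αₖ, β₁ ∧ ⋯ ∧ βₖ) = det (g(αᵢ, βⱼ))` where `g(α, β) = α (sharp g β)` on `V*`. -/
noncomputable def formInner {F : Type u} {V : Type v} [Field F] [AddCommGroup V] [Module F V]
    (g : LinearMap.BilinForm F V) {k : ℕ} (χ φ : Form F V k) : F :=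
  exteriorPower.pairingDual F V k χ (exteriorPower.map k (sharp g) φ)

/-- `χ` is the Hodge dual `⋆ψ` with respect to `g` and `vol`:
`ψ ∧ φ = g(χ, φ) vol` for all forms `φ` of the complementary degree. -/
def IsHodgeDual {F : Type u} {V : Type v} [Field F] [AddCommGroup V] [Module F V]
    (g : LinearMap.BilinForm F V) {n k l : ℕ} (vol : Form F V n)
    (ψ : Form F V k) (χ : Form F V l) : Prop :=
  ∀ φ : Form F V l,
    (ψ : ExteriorAlgebra F (Dual F V)) * (φ : ExteriorAlgebra F (Dual F V)) =
      formInner g χ φ • (vol : ExteriorAlgebra F (Dual F V))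

/-! ### The model forms

The vectors of a basis are numbered from `0` to `6` here, and from `1` to `7` in the comments. -/

/-- `e^{i₁ ⋯ iₖ} = e^{i₁} ∧ ⋯ ∧ e^{iₖ}`, where `e¹, …, e⁷` is the dual basis of `b`. -/
noncomputable def mono {F : Type u} {V : Type v} [Field F] [AddCommGroup V] [Module F V]
    (b : Basis (Fin 7) F V) {k : ℕ} (i : Fin k → Fin 7) : Form F V k :=
  exteriorPower.ιMulti F k (fun j => b.coord (i j))

/-- `e^{1234567}`. -/
noncomputable def volForm {F : Type u} {V : Type v} [Field F] [AddCommGroup V] [Module F V]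
    (b : Basis (Fin 7) F V) : Form F V 7 :=
  mono b ![0, 1, 2, 3, 4, 5, 6]

/-- `e^{127} + e^{347} + e^{567} + e^{135} - e^{146} - e^{236} - e^{245}`. -/
noncomputable def g2Form {F : Type u} {V : Type v} [Field F] [AddCommGroup V] [Module F V]
    (b : Basis (Fin 7) F V) : Form F V 3 :=
  mono b ![0, 1, 6] + mono b ![2, 3, 6] + mono b ![4, 5, 6] + mono b ![0, 2, 4]
    - mono b ![0, 3, 5] - mono b ![1, 2, 5] - mono b ![1, 3, 4]

/-- `-e^{127} - e^{347} + e^{567} + e^{135} - e^{146} - e^{236} - e^{245}`. -/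
noncomputable def g2StarForm {F : Type u} {V : Type v} [Field F] [AddCommGroup V] [Module F V]
    (b : Basis (Fin 7) F V) : Form F V 3 :=
  - mono b ![0, 1, 6] - mono b ![2, 3, 6] + mono b ![4, 5, 6] + mono b ![0, 2, 4]
    - mono b ![0, 3, 5] - mono b ![1, 2, 5] - mono b ![1, 3, 4]

/-- `g(v, w) vol = (1/6) (v ⌟ φ) ∧ (w ⌟ φ) ∧ φ` for all vectors `v`, `w`. -/
def IsInducedMetric {F : Type u} {V : Type v} [Field F] [AddCommGroup V] [Module F V]
    (φ : Form F V 3) (vol : Form F V 7) (g : LinearMap.BilinForm F V) : Prop :=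
  ∀ v w : V, g v w • (vol : ExteriorAlgebra F (Dual F V)) =
    (1 / 6 : F) • (hook v φ * hook w φ * (φ : ExteriorAlgebra F (Dual F V)))

/-- `φ` is a `G₂`-structure on the real vector space `V`, and `vol` and `g` are the volume form and
the metric that it induces: an adapted basis of `φ` is oriented and orthonormal. Over the reals all
adapted bases of `φ` define the same volume form. -/
structure IsG2Structure {V : Type v} [AddCommGroup V] [Module ℝ V]
    (φ : Form ℝ V 3) (vol : Form ℝ V 7) (g : LinearMap.BilinForm ℝ V) : Prop where
  adapted : ∃ b : Basis (Fin 7) ℝ V, φ = g2Form b ∧ vol = volForm b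
  metric : IsInducedMetric φ vol g

/-- `φ` is a `G₂*`-structure on the real vector space `V`, and `vol` and `g` are the volume form and
the pseudo-Euclidean metric of signature `(3, 4)` that it induces. Over the reals all adapted bases
of `φ` define the same volume form. -/
structure IsG2StarStructure {V : Type v} [AddCommGroup V] [Module ℝ V]
    (φ : Form ℝ V 3) (vol : Form ℝ V 7) (g : LinearMap.BilinForm ℝ V) : Prop where
  adapted : ∃ b : Basis (Fin 7) ℝ V, φ = g2StarForm b ∧ vol = volForm b
  metric : IsInducedMetric φ vol g

/-- The pair `(φ, vol)` is a `(G₂)_ℂ`-structure on the complex vector space `W`, and `g` is the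
complex symmetric bilinear form that it induces. -/
structure IsG2CStructure {W : Type v} [AddCommGroup W] [Module ℂ W]
    (φ : Form ℂ W 3) (vol : Form ℂ W 7) (g : LinearMap.BilinForm ℂ W) : Prop where
  adapted : ∃ b : Basis (Fin 7) ℂ W, φ = g2Form b ∧ vol = volForm b
  metric : IsInducedMetric φ vol g

/-! ### The exterior derivative on a Lie algebra -/

/-- The exterior derivative on forms on a Lie algebra (left-invariant forms on the group),
`dχ(x₀, …, xₘ) = ∑_{i < j} (-1)^{i+j} χ([xᵢ, xⱼ], x₀, …, x̂ᵢ, …, x̂ⱼ, …, xₘ)`,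
as a function of `m + 1 = k + 2` vectors; `dα(x, y) = -α([x, y])` for a one-form `α`. -/
noncomputable def lieD {F : Type u} {L : Type v} [Field F] [LieRing L] [LieAlgebra F L] {k : ℕ}
    (χ : Form F L (k + 1)) (x : Fin (k + 2) → L) : F :=
  ∑ j : Fin (k + 2), ∑ i : Fin (k + 1),
    if i.castSucc < j then
      (-1 : F) ^ ((i : ℕ) + (j : ℕ)) *
        formEval χ (Matrix.vecCons ⁅x i.castSucc, x j⁆ (i.removeNth (j.removeNth x)))
    else 0

/-- `dχ = 0`. -/
def IsClosedForm {F : Type u} {L : Type v} [Field F] [LieRing L] [LieAlgebra F L] {k : ℕ}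
    (χ : Form F L (k + 1)) : Prop :=
  ∀ x : Fin (k + 2) → L, lieD χ x = 0

/-- The three-form `φ` is cocalibrated with respect to `vol` and `g`: `⋆φ` is closed. -/
def IsCocalibrated {F : Type u} {L : Type v} [Field F] [LieRing L] [LieAlgebra F L]
    (φ : Form F L 3) (vol : Form F L 7) (g : LinearMap.BilinForm F L) : Prop :=
  ∃ χ : Form F L 4, IsHodgeDual g vol φ χ ∧ IsClosedForm χ

/-- An element of `Λᵏ (Ann⟨e⟩)`, where `Ann⟨e⟩ ⊆ L*` is the annihilator of `e`, as a form on `L`. -/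
noncomputable def annForm {F : Type u} {L : Type v} [Field F] [AddCommGroup L] [Module F L]
    {e : L} {k : ℕ} (Ω : ⋀[F]^k (Submodule.dualAnnihilator (Submodule.span F {e}))) : Form F L k :=
  exteriorPower.map k (Submodule.subtype (Submodule.dualAnnihilator (Submodule.span F {e}))) Ω

end CocalibratedG2

/-!
Fix `η ∈ 𝔤*` with kernel `𝔲` and `η(e₇) = 1`, and let `D = ad e₇`. As `𝔲` is an abelian ideal,
`[x, y] = η(x) D y - η(y) D x`, so the multiples of `η` are closed and a four-form is closed exactly
if its component in `Λ⁴ Ann⟨e₇⟩` is. It remains to determine which `Ω ∈ Λ⁴ Ann⟨e₇⟩` are the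
component of some `⋆φ`.

The map `(x, y) ↦ x ∧ y ∧ Ω` is an alternating bilinear form on the six-dimensional `Ann⟨e₇⟩` and
determines `Ω`. Its symplectic normal form, of rank `2 r`, shows that `Ω` is up to a factor one of
four standard four-vectors, with `l(Ω) ≤ r ≤ 3`. Explicit adapted bases realise the standard
four-vector with `r = 3` for both signs `ε` and the one with `r = 2` for `ε = -1`.

Conversely, a sum of `l` decomposable four-vectors is annihilated, after multiplication by `η`, by
all one-forms in a space of dimension at least `7 - 2 l`. For the component `Ω` of `⋆φ_ε` the
one-forms `x` with `x ∧ η ∧ Ω = x ∧ η ∧ ⋆φ_ε = 0` are those with vanishing cross product `x × η`.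
By the identity `x × (x × y) = g(x, y) x - g(x, x) y` they are the multiples of `η` if
`g(η, η) ≠ 0`, so that `l(Ω) = 3`, and form a totally isotropic subspace, of dimension at most
three, if `g(η, η) = 0`, so that `l(Ω) ≥ 2`. The condition `g(η, η) ≠ 0` says that `𝔲` is
non-degenerate.

For `ε = 1` over `ℝ` the metric is definite, and if `-1` is a square the two signs are equivalent.
-/

namespace CocalibratedG2

open Module ExteriorAlgebra

/-! ### Exterior products of basis vectors as words -/

section Words

/-- Formal integral combinations of words in the letters `0, …, n - 1`. An identity between explicit
polynomials in the elements of a finite family of vectors of an exterior algebra is deduced from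
`WordSum.equiv`, which is decidable, for formal combinations with these values. -/
abbrev WordSum (n : ℕ) := List (ℤ × List (Fin n))

namespace WordSum

variable {m n : ℕ}

/-- The multiple of a formal combination by an integer. -/
def smul (c : ℤ) (p : WordSum n) : WordSum n := p.map fun t => (c * t.1, t.2)

/-- The product of formal combinations, given by concatenation of words. -/
def mul (p q : WordSum n) : WordSum n :=
  p.flatMap fun s => q.map fun t => (s.1 * t.1, s.2 ++ t.2)

/-- The substitution of formal combinations `E i` for the letters `i` of a formal combination. -/
def subst (E : Fin m → WordSum n) (p : WordSum m) : WordSum n :=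
  p.flatMap fun t => smul t.1 (t.2.foldr (fun i q => (E i).mul q) [(1, [])])

/-- The contraction of a word with the element of the dual basis that belongs to the letter `i`. -/
def contractWord (i : Fin n) : List (Fin n) → WordSum n
  | [] => []
  | j :: l => (if i = j then [(1, l)] else []) ++ mul [(-1, [j])] (contractWord i l)

/-- The contraction of a formal combination with the element of the dual basis that belongs to the
letter `i`. -/
def contract (i : Fin n) (p : WordSum n) : WordSum n :=
  p.flatMap fun t => smul t.1 (contractWord i t.2)

/-- The insertion of a letter into a sorted word by transpositions of anticommuting letters: the
resulting sign (`0` if the letter occurs in the word) and the resulting word. -/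
def insertLetter (i : Fin n) : List (Fin n) → ℤ × List (Fin n)
  | [] => (1, [i])
  | j :: l =>
    if i < j then (1, i :: j :: l)
    else if i = j then (0, [])
    else (-(insertLetter i l).1, j :: (insertLetter i l).2)

/-- The sorting of a word of anticommuting letters: the resulting sign (`0` if a letter is repeated)
and the resulting word. -/
def sortWord : List (Fin n) → ℤ × List (Fin n)
  | [] => (1, [])
  | i :: l => ((sortWord l).1 * (insertLetter i (sortWord l).2).1,
      (insertLetter i (sortWord l).2).2)

/-- The addition of a term to a formal combination, merged with a term of the same word. -/
def addTerm (c : ℤ) (l : List (Fin n)) : WordSum n → WordSum n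
  | [] => [(c, l)]
  | t :: p => if t.2 = l then (t.1 + c, t.2) :: p else t :: addTerm c l p

/-- The formal combination with all words sorted and equal words merged. -/
def normalize (p : WordSum n) : WordSum n :=
  p.foldr (fun t q => addTerm (t.1 * (sortWord t.2).1) (sortWord t.2).2 q) []

/-- All coefficients of the normalization of `p - q` vanish. -/
def equiv (p q : WordSum n) : Bool := (normalize (p ++ q.smul (-1))).all fun t => t.1 == 0

variable (R : Type*) {W : Type*} [CommRing R] [AddCommGroup W] [Module R W] (f : Fin n → W)

/-- The product in the exterior algebra of the vectors `f i` along the letters `i` of a word. -/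
noncomputable def wordProd (l : List (Fin n)) : ExteriorAlgebra R W :=
  (l.map fun i => ι R (f i)).prod

/-- The value of a formal combination of words in the exterior algebra at a family of vectors. -/
noncomputable def eval (p : WordSum n) : ExteriorAlgebra R W :=
  (p.map fun t => t.1 • wordProd R f t.2).sum

@[simp] lemma wordProd_nil : wordProd R f [] = 1 := rfl

@[simp] lemma wordProd_cons (i : Fin n) (l : List (Fin n)) :
    wordProd R f (i :: l) = ι R (f i) * wordProd R f l := by
  simp [wordProd]

lemma wordProd_append (l l' : List (Fin n)) :
    wordProd R f (l ++ l') = wordProd R f l * wordProd R f l' := by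
  simp [wordProd]

@[simp] lemma eval_nil : eval R f [] = 0 := rfl

@[simp] lemma eval_cons (t : ℤ × List (Fin n)) (p : WordSum n) :
    eval R f (t :: p) = t.1 • wordProd R f t.2 + eval R f p := by
  simp [eval]

lemma eval_append (p q : WordSum n) : eval R f (p ++ q) = eval R f p + eval R f q := by
  simp [eval]

lemma eval_smul (c : ℤ) (p : WordSum n) : eval R f (p.smul c) = c • eval R f p := by
  simp only [eval, smul, List.map_map, Function.comp_def, mul_smul, List.smul_sum]

lemma eval_flatMap {α : Type*} (l : List α) (g : α → WordSum n) :
    eval R f (l.flatMap g) = (l.map fun t => eval R f (g t)).sum := by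
  induction l with
  | nil => rfl
  | cons t l ih => rw [List.flatMap_cons, eval_append, ih, List.map_cons, List.sum_cons]

lemma eval_mul (p q : WordSum n) : eval R f (p.mul q) = eval R f p * eval R f q := by
  have eval_map (s : ℤ × List (Fin n)) : eval R f (q.map fun t => (s.1 * t.1, s.2 ++ t.2)) =
      s.1 • wordProd R f s.2 * eval R f q := by
    simp only [eval, List.map_map, Function.comp_def, wordProd_append, ← smul_mul_smul_comm,
      List.sum_map_mul_left]
  simp only [mul, eval_flatMap, eval_map, List.sum_map_mul_right]
  rfl

variable {f}

lemma eval_subst {g : Fin m → W} {E : Fin m → WordSum n} (hE : ∀ i, eval R f (E i) = ι R (g i))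
    (p : WordSum m) : eval R f (p.subst E) = eval R g p := by
  have eval_foldr (l : List (Fin m)) :
      eval R f (l.foldr (fun i q => (E i).mul q) [(1, [])]) = wordProd R g l := by
    induction l with
    | nil => simp
    | cons i l ih => rw [List.foldr_cons, eval_mul, ih, hE, wordProd_cons]
  simp only [subst, eval_flatMap, eval_smul, eval_foldr]
  rfl

variable {d : Dual R W} {i : Fin n} (hd : ∀ j, d (f j) = if i = j then 1 else 0)

include hd

lemma contractLeft_wordProd (l : List (Fin n)) :
    CliffordAlgebra.contractLeft d (wordProd R f l) = eval R f (contractWord i l) := by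
  induction l with
  | nil => simp [contractWord]
  | cons j l ih =>
    rw [wordProd_cons, contractWord, eval_append, eval_mul, ← ih,
      CliffordAlgebra.contractLeft_ι_mul, hd]
    split_ifs <;> simp [sub_eq_add_neg]

lemma contractLeft_eval (p : WordSum n) :
    CliffordAlgebra.contractLeft d (eval R f p) = eval R f (p.contract i) := by
  simp only [contract, eval_flatMap, eval_smul, ← contractLeft_wordProd R hd]
  simp only [eval, map_list_sum, List.map_map, Function.comp_def, map_zsmul]

omit hd

lemma ι_mul_wordProd (i : Fin n) (l : List (Fin n)) :
    ι R (f i) * wordProd R f l = (insertLetter i l).1 • wordProd R f (insertLetter i l).2 := by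
  induction l with
  | nil => simp [insertLetter]
  | cons j l ih =>
    unfold insertLetter
    split_ifs with hlt heq
    · simp
    · simp [heq, ← mul_assoc]
    · rw [wordProd_cons, ← mul_assoc, eq_neg_of_add_eq_zero_left (ι_add_mul_swap (f i) (f j)),
        neg_mul, mul_assoc, ih, wordProd_cons, mul_smul_comm, neg_smul]

lemma wordProd_eq_sortWord (l : List (Fin n)) :
    wordProd R f l = (sortWord l).1 • wordProd R f (sortWord l).2 := by
  induction l with
  | nil => simp [sortWord]
  | cons i l ih => rw [wordProd_cons, ih, mul_smul_comm, ι_mul_wordProd, smul_smul, sortWord]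

lemma eval_addTerm (c : ℤ) (l : List (Fin n)) (p : WordSum n) :
    eval R f (p.addTerm c l) = c • wordProd R f l + eval R f p := by
  induction p with
  | nil => simp [addTerm]
  | cons t p ih =>
    unfold addTerm
    split_ifs with heq
    · rw [eval_cons, eval_cons, ← heq, add_smul]; abel
    · rw [eval_cons, eval_cons, ih]; abel

lemma eval_normalize (p : WordSum n) : eval R f p.normalize = eval R f p := by
  induction p with
  | nil => rfl
  | cons t p ih =>
    rw [normalize, List.foldr_cons, eval_addTerm, ← normalize, ih, eval_cons, mul_smul,
      ← wordProd_eq_sortWord]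

lemma eval_eq_of_equiv {p q : WordSum n} (h : equiv p q = true) : eval R f p = eval R f q := by
  have hzero : eval R f (p ++ q.smul (-1)) = 0 := by
    rw [← eval_normalize, eval]
    refine List.sum_eq_zero fun x hx => ?_
    obtain ⟨t, ht, rfl⟩ := List.mem_map.1 hx
    rw [beq_iff_eq.1 (List.all_eq_true.1 h t ht), zero_smul]
  rwa [eval_append, eval_smul, neg_one_smul, add_neg_eq_zero] at hzero

variable (f) in
lemma coe_ιMulti {k : ℕ} (i : Fin k → Fin n) :
    (exteriorPower.ιMulti R k (f ∘ i) : ExteriorAlgebra R W) = wordProd R f (List.ofFn i) := by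
  rw [exteriorPower.ιMulti_apply_coe, ιMulti_apply, wordProd, List.map_ofFn]
  rfl

end WordSum

end Words

/-! ### The metric and the Hodge dual of the model forms -/

section HodgeDual

variable {F V : Type*} [Field F] [AddCommGroup V] [Module F V]

lemma pairingDual_injective [FiniteDimensional F V] (k : ℕ) :
    Function.Injective (exteriorPower.pairingDual F V k) := by
  let b := Module.finBasis F V
  let B := b.exteriorPower k
  have heq : exteriorPower.pairingDual F V k =
      ((b.dualBasis.exteriorPower k).equiv B.dualBasis (.refl _)).toLinearMap := by
    refine (b.dualBasis.exteriorPower k).ext fun s => ?_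
    rw [LinearEquiv.coe_coe, Basis.equiv_apply, exteriorPower.basis_apply, Basis.coe_dualBasis,
      Basis.coe_dualBasis, Equiv.refl_apply, exteriorPower.basis_coord]
    rfl
  rw [heq]
  exact LinearEquiv.injective _

lemma sharp_apply_apply {g : LinearMap.BilinForm F V}
    (hg : Function.Bijective (g : V →ₗ[F] Dual F V)) (v : V) : sharp g (g v) = v := by
  rw [sharp, dif_pos hg]
  exact (LinearEquiv.ofBijective (g : V →ₗ[F] Dual F V) hg).symm_apply_apply v

variable [FiniteDimensional F V] {g : LinearMap.BilinForm F V}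

lemma bijective_of_nondegenerate (hg : g.Nondegenerate) :
    Function.Bijective (g : V →ₗ[F] Dual F V) :=
  (g.toDual hg).bijective

lemma IsHodgeDual.unique {n k l : ℕ} {vol : Form F V n} (hvol : vol ≠ 0) (hg : g.Nondegenerate)
    {ψ : Form F V k} {χ χ' : Form F V l} (h : IsHodgeDual g vol ψ χ)
    (h' : IsHodgeDual g vol ψ χ') : χ = χ' := by
  have hsharp : Function.Surjective (sharp g) := fun v =>
    ⟨g v, sharp_apply_apply (bijective_of_nondegenerate hg) v⟩
  refine pairingDual_injective l (LinearMap.ext fun X => ?_)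
  obtain ⟨φ, rfl⟩ := exteriorPower.map_surjective hsharp X
  exact smul_left_injective F (mt Submodule.coe_eq_zero.1 hvol) ((h φ).symm.trans (h' φ))

end HodgeDual

section Model

variable {F V : Type*} [Field F] [AddCommGroup V] [Module F V]

lemma IsInducedMetric.unique {φ : Form F V 3} {vol : Form F V 7} {g g' : LinearMap.BilinForm F V}
    (hvol : vol ≠ 0) (h : IsInducedMetric φ vol g) (h' : IsInducedMetric φ vol g') : g = g' :=
  LinearMap.ext₂ fun v w =>
    smul_left_injective F (mt Submodule.coe_eq_zero.1 hvol) ((h v w).trans (h' v w).symm)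

/-- The form `φ_ε`, where the sign `ε` is a unit of `ℤ`. -/
noncomputable def phiForm (ε : ℤˣ) (b : Basis (Fin 7) F V) : Form F V 3 :=
  (ε : ℤ) • mono b ![0, 1, 6] + (ε : ℤ) • mono b ![2, 3, 6] + mono b ![4, 5, 6]
    + mono b ![0, 2, 4] - mono b ![0, 3, 5] - mono b ![1, 2, 5] - mono b ![1, 3, 4]

/-- The Hodge dual of `φ_ε`. -/
noncomputable def starForm (ε : ℤˣ) (b : Basis (Fin 7) F V) : Form F V 4 :=
  mono b ![0, 1, 2, 3] + (ε : ℤ) • mono b ![2, 3, 4, 5] + (ε : ℤ) • mono b ![0, 1, 4, 5]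
    - mono b ![1, 3, 5, 6] + mono b ![1, 2, 4, 6] + mono b ![0, 3, 4, 6] + mono b ![0, 2, 5, 6]

/-- The square `g(eᵢ, eᵢ)` of a vector of an adapted basis of `φ_ε`. -/
def metricSign (ε : ℤˣ) (i : Fin 7) : ℤˣ := if i < 4 then ε else 1

/-- The metric induced by `φ_ε`, for which the adapted basis is orthonormal. -/
noncomputable def metric (ε : ℤˣ) (b : Basis (Fin 7) F V) : LinearMap.BilinForm F V :=
  Matrix.toBilin b (Matrix.diagonal fun i => ((metricSign ε i : ℤ) : F))

/-- `φ_ε` as a formal combination of words. -/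
def phiWords (ε : ℤˣ) : WordSum 7 :=
  [(ε, [0, 1, 6]), (ε, [2, 3, 6]), (1, [4, 5, 6]), (1, [0, 2, 4]), (-1, [0, 3, 5]),
    (-1, [1, 2, 5]), (-1, [1, 3, 4])]

/-- The Hodge dual of `φ_ε` as a formal combination of words. -/
def starWords (ε : ℤˣ) : WordSum 7 :=
  [(1, [0, 1, 2, 3]), (ε, [2, 3, 4, 5]), (ε, [0, 1, 4, 5]), (-1, [1, 3, 5, 6]),
    (1, [1, 2, 4, 6]), (1, [0, 3, 4, 6]), (1, [0, 2, 5, 6])]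

/-- `e^{1234567}` as a formal combination of words. -/
def volWords : WordSum 7 := [(1, [0, 1, 2, 3, 4, 5, 6])]

variable (ε : ℤˣ) (b : Basis (Fin 7) F V)

lemma coe_mono {k : ℕ} (i : Fin k → Fin 7) :
    (mono b i : ExteriorAlgebra F (Dual F V)) = WordSum.wordProd F b.coord (List.ofFn i) :=
  WordSum.coe_ιMulti F b.coord i

lemma coe_phiForm :
    (phiForm ε b : ExteriorAlgebra F (Dual F V)) = WordSum.eval F b.coord (phiWords ε) := by
  simp only [phiForm, Submodule.coe_add, Submodule.coe_sub, Submodule.coe_smul_of_tower, coe_mono,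
    phiWords, WordSum.eval_cons, WordSum.eval_nil, List.ofFn_succ, List.ofFn_zero,
    Matrix.cons_val_zero, Matrix.cons_val_succ, one_smul, neg_smul]
  abel

lemma coe_starForm :
    (starForm ε b : ExteriorAlgebra F (Dual F V)) = WordSum.eval F b.coord (starWords ε) := by
  simp only [starForm, Submodule.coe_add, Submodule.coe_sub, Submodule.coe_smul_of_tower, coe_mono,
    starWords, WordSum.eval_cons, WordSum.eval_nil, List.ofFn_succ, List.ofFn_zero,
    Matrix.cons_val_zero, Matrix.cons_val_succ, one_smul, neg_smul]
  abel

lemma coe_volForm :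
    (volForm b : ExteriorAlgebra F (Dual F V)) = WordSum.eval F b.coord volWords := by
  simp only [volForm, coe_mono, volWords, WordSum.eval_cons, WordSum.eval_nil, List.ofFn_succ,
    List.ofFn_zero, Matrix.cons_val_zero, Matrix.cons_val_succ, one_smul, add_zero]

lemma pairingDual_mono_ιMulti {k : ℕ} {i j : Fin k → Fin 7} (hi : StrictMono i)
    (hj : StrictMono j) :
    exteriorPower.pairingDual F V k (mono b i) (exteriorPower.ιMulti F k (b ∘ j)) =
      if i = j then 1 else 0 := by
  have hself : ∀ i, b.coord i (b i) = 1 := by simp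
  have hne : ∀ ⦃i j⦄, i ≠ j → b.coord i (b j) = 0 := fun i j hij => by simp [hij.symm]
  split_ifs with h
  · subst h
    exact exteriorPower.pairingDual_apply_apply_eq_one _ _ hself hne k
      (OrderEmbedding.ofStrictMono i hi)
  · exact exteriorPower.pairingDual_apply_apply_eq_one_zero _ _ hne k
      (OrderEmbedding.ofStrictMono i hi) (OrderEmbedding.ofStrictMono j hj)
      fun h' => h (congrArg DFunLike.coe h')

lemma volForm_ne_zero : volForm b ≠ 0 := by
  have hmono : StrictMono (![0, 1, 2, 3, 4, 5, 6] : Fin 7 → Fin 7) := by decide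
  intro h
  have hpair := pairingDual_mono_ιMulti b hmono hmono
  rw [← volForm, h, map_zero, LinearMap.zero_apply, if_pos rfl] at hpair
  exact zero_ne_one hpair

lemma metricSign_mul_self (i : Fin 7) : ((metricSign ε i : ℤ) : F) * (metricSign ε i : ℤ) = 1 := by
  rw [← Int.cast_mul, Int.units_coe_mul_self, Int.cast_one]

lemma metric_apply (v w : V) :
    metric ε b v w = ∑ i, ((metricSign ε i : ℤ) : F) * (b.coord i v * b.coord i w) := by
  simp only [metric, Matrix.toBilin_apply, Matrix.diagonal_apply, mul_ite, ite_mul, mul_zero,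
    zero_mul, Finset.sum_ite_eq, Finset.mem_univ, if_true, Basis.coord_apply]
  exact Finset.sum_congr rfl fun i _ => by ring

lemma metric_isSymm : (metric ε b).IsSymm :=
  (Matrix.isSymm_toBilin_iff_isSymm b).2 (Matrix.isSymm_diagonal _)

lemma metric_nondegenerate : (metric ε b).Nondegenerate := by
  refine (LinearMap.BilinForm.nondegenerate_iff_det_ne_zero b).2 ?_
  rw [metric, LinearMap.BilinForm.toMatrix_toBilin, Matrix.det_diagonal]
  exact Finset.prod_ne_zero_iff.2 fun i _ => left_ne_zero_of_mul_eq_one (metricSign_mul_self ε i)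

lemma metric_basis (i : Fin 7) : metric ε b (b i) = ((metricSign ε i : ℤ) : F) • b.coord i := by
  ext v
  simp [metric_apply, Finsupp.single_apply]

lemma sharp_metric_coord (i : Fin 7) :
    sharp (metric ε b) (b.coord i) = ((metricSign ε i : ℤ) : F) • b i := by
  have := Module.Finite.of_basis b
  have h := sharp_apply_apply (bijective_of_nondegenerate (metric_nondegenerate ε b))
    (((metricSign ε i : ℤ) : F) • b i)
  rwa [map_smul, metric_basis, smul_smul, metricSign_mul_self, one_smul] at h

lemma hook_eval (i : Fin 7) (p : WordSum 7) :
    hook (b i) (WordSum.eval F b.coord p) = WordSum.eval F b.coord (p.contract i) :=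
  WordSum.contractLeft_eval F (fun j => by simp [Finsupp.single_apply]) p

lemma hook_mul_hook_mul_phiWords (i j : Fin 7) :
    WordSum.equiv ((((phiWords ε).contract i).mul ((phiWords ε).contract j)).mul (phiWords ε))
      (volWords.smul (if i = j then 6 * metricSign ε i else 0)) = true := by
  decide +kernel +revert

lemma isInducedMetric_metric [NeZero (6 : F)] :
    IsInducedMetric (phiForm ε b) (volForm b) (metric ε b) := by
  let φ : ExteriorAlgebra F (Dual F V) := phiForm ε b
  let vol : ExteriorAlgebra F (Dual F V) := volForm b
  let hookφ : V →ₗ[F] ExteriorAlgebra F (Dual F V) :=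
    CliffordAlgebra.contractLeft.flip φ ∘ₗ Dual.eval F V
  suffices (metric ε b).compr₂ (LinearMap.toSpanSingleton F _ vol) =
      (1 / 6 : F) • ((LinearMap.mul F _).compl₁₂ hookφ hookφ).compr₂ (LinearMap.mulRight F φ) from
    fun v w => LinearMap.congr_fun₂ this v w
  refine b.ext fun i => b.ext fun j => ?_
  have h : hook (b i) φ * hook (b j) φ * φ =
      (if i = j then 6 * metricSign ε i else 0 : ℤ) • vol := by
    simp only [φ, vol, coe_phiForm, coe_volForm, hook_eval, ← WordSum.eval_mul,
      ← WordSum.eval_smul]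
    exact WordSum.eval_eq_of_equiv F (hook_mul_hook_mul_phiWords ε i j)
  change metric ε b (b i) (b j) • vol = (1 / 6 : F) • (hook (b i) φ * hook (b j) φ * φ)
  rw [h, metric_basis, ← Int.cast_smul_eq_zsmul F, smul_smul]
  congr 1
  by_cases hij : i = j
  · subst hij
    simp [← mul_assoc, inv_mul_cancel₀ (NeZero.ne (6 : F))]
  · simp [hij]

/-- The coefficient of `⋆φ_ε` at `e^{ijkl}`, multiplied by `g(e^{ijkl}, e^{ijkl})`. -/
def starCoeff (l : List (Fin 7)) : ℤ :=
  (l.map fun i => (metricSign ε i : ℤ)).prod *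
    ((starWords ε).map fun t => t.1 * if t.2 = l then 1 else 0).sum

lemma phiWords_mul (i j k l : Fin 7) : i < j → j < k → k < l →
    WordSum.equiv ((phiWords ε).mul [(1, [i, j, k, l])])
      (volWords.smul (starCoeff ε [i, j, k, l])) = true := by
  decide +kernel +revert

lemma formInner_starForm_mono {i : Fin 4 → Fin 7} (hi : StrictMono i) :
    formInner (metric ε b) (starForm ε b) (mono b i) = (starCoeff ε (List.ofFn i) : F) := by
  have hmap : exteriorPower.map 4 (sharp (metric ε b)) (mono b i) =
      (∏ j, ((metricSign ε (i j) : ℤ) : F)) • exteriorPower.ιMulti F 4 (b ∘ i) := by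
    rw [mono, exteriorPower.map_apply_ιMulti, ← AlternatingMap.map_smul_univ]
    exact congrArg _ (funext fun j => sharp_metric_coord ε b (i j))
  have hpair (j : Fin 4 → Fin 7) (hj : StrictMono j) : exteriorPower.pairingDual F V 4 (mono b j)
      (exteriorPower.ιMulti F 4 (b ∘ i)) = if List.ofFn j = List.ofFn i then 1 else 0 := by
    simp only [pairingDual_mono_ιMulti b hj hi, List.ofFn_inj]
  rw [formInner, hmap, map_smul, starForm]
  simp only [map_add, map_sub, map_zsmul, LinearMap.add_apply, LinearMap.sub_apply,
    LinearMap.smul_apply]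
  rw [hpair _ (by decide), hpair _ (by decide), hpair _ (by decide), hpair _ (by decide),
    hpair _ (by decide), hpair _ (by decide), hpair _ (by decide)]
  simp [starCoeff, starWords, Fin.prod_univ_four, sub_eq_add_neg, add_assoc, mul_assoc, -mul_ite,
    -smul_ite]

lemma isHodgeDual_starForm :
    IsHodgeDual (metric ε b) (volForm b) (phiForm ε b) (starForm ε b) := by
  suffices LinearMap.mulLeft F (phiForm ε b : ExteriorAlgebra F (Dual F V)) ∘ₗ
      Submodule.subtype (⋀[F]^4 (Dual F V)) =
      LinearMap.toSpanSingleton F _ (volForm b : ExteriorAlgebra F (Dual F V)) ∘ₗ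
      exteriorPower.pairingDual F V 4 (starForm ε b) ∘ₗ
        exteriorPower.map 4 (sharp (metric ε b)) from fun χ => LinearMap.congr_fun this χ
  refine (b.dualBasis.exteriorPower 4).ext fun s => ?_
  let i := Set.powersetCard.ofFinEmbEquiv.symm s
  have hbasis : b.dualBasis.exteriorPower 4 s = mono b i := by
    rw [exteriorPower.basis_apply, exteriorPower.ιMulti_family, Basis.coe_dualBasis]
    rfl
  change (phiForm ε b : ExteriorAlgebra F (Dual F V)) * (b.dualBasis.exteriorPower 4 s) =
    formInner (metric ε b) (starForm ε b) _ • (volForm b : ExteriorAlgebra F (Dual F V))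
  have hword : (mono b i : ExteriorAlgebra F (Dual F V)) =
      WordSum.eval F b.coord [(1, [i 0, i 1, i 2, i 3])] := by
    simp [coe_mono, List.ofFn_succ]
  rw [hbasis, formInner_starForm_mono ε b i.strictMono, hword, coe_phiForm, coe_volForm,
    Int.cast_smul_eq_zsmul, ← WordSum.eval_mul, ← WordSum.eval_smul]
  have hlist : List.ofFn i = [i 0, i 1, i 2, i 3] := by simp [List.ofFn_succ]
  rw [hlist]
  exact WordSum.eval_eq_of_equiv F
    (phiWords_mul ε _ _ _ _ (i.strictMono (by decide)) (i.strictMono (by decide))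
      (i.strictMono (by decide)))

end Model

/-! ### Closed forms on an almost abelian Lie algebra -/

section Alternating

variable {R M N : Type*} [CommRing R] [AddCommGroup M] [Module R M] [AddCommGroup N] [Module R N]

lemma alternatingMap_add_smul {n : ℕ} (A : M [⋀^Fin (n + 1)]→ₗ[R] N) (x : Fin (n + 1) → M)
    (c : Fin (n + 1) → R) (e : M) :
    A (fun i => x i + c i • e) =
      A x + ∑ p : Fin (n + 1), (-1) ^ (p : ℕ) • c p • A (Matrix.vecCons e (p.removeNth x)) := by
  have hrepeat : ∀ s : Finset (Fin (n + 1)), 2 ≤ s.card →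
      A.toMultilinearMap (s.piecewise (fun i => c i • e) x) = 0 := by
    intro s hs
    obtain ⟨i, hi, j, hj, hij⟩ := Finset.one_lt_card.1 hs
    have hscale : s.piecewise (fun i => c i • e) x =
        fun i => s.piecewise c 1 i • s.piecewise (fun _ => e) x i := by
      funext i
      by_cases h : i ∈ s <;> simp [h]
    rw [hscale, AlternatingMap.coe_multilinearMap, AlternatingMap.map_smul_univ,
      A.map_eq_zero_of_eq _ (by simp [hi, hj]) hij, smul_zero]
  have hexpand := A.toMultilinearMap.map_add_eq_map_add_linearDeriv_add x fun i => c i • e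
  rw [Finset.sum_eq_zero (fun s hs => hrepeat s (Finset.mem_filter.1 hs).2), add_zero,
    MultilinearMap.linearDeriv_apply] at hexpand
  refine hexpand.trans (congrArg₂ _ rfl (Finset.sum_congr rfl fun p _ => ?_))
  rw [MultilinearMap.map_update_smul, AlternatingMap.coe_multilinearMap, ← Fin.insertNth_removeNth,
    AlternatingMap.map_insertNth, smul_comm]

end Alternating

section FormEval

variable {F V : Type*} [Field F] [AddCommGroup V] [Module F V]

lemma formEval_ιMulti {k : ℕ} (v : Fin k → Dual F V) (x : Fin k → V) :
    formEval (exteriorPower.ιMulti F k v) x = Matrix.det (Matrix.of fun i j => v j (x i)) := by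
  rw [formEval, exteriorPower.alternatingMapLinearEquiv_symm_apply,
    LinearMap.compAlternatingMap_apply, exteriorPower.pairingDual_ιMulti_ιMulti]

lemma formEval_map_dualMap {k : ℕ} (P : V →ₗ[F] V) (χ : Form F V k) (x : Fin k → V) :
    formEval (exteriorPower.map k P.dualMap χ) x = formEval χ fun i => P (x i) := by
  let evalAt (y : Fin k → V) : Form F V k →ₗ[F] F :=
    (LinearMap.applyₗ (exteriorPower.ιMulti F k y)).comp (exteriorPower.pairingDual F V k)
  have heval : evalAt x ∘ₗ exteriorPower.map k P.dualMap = evalAt fun i => P (x i) := by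
    refine exteriorPower.linearMap_ext (AlternatingMap.ext fun v => ?_)
    exact (congrArg (evalAt x) (exteriorPower.map_apply_ιMulti _ _)).trans
      ((formEval_ιMulti _ x).trans (formEval_ιMulti v _).symm)
  exact LinearMap.congr_fun heval χ

/-- The projection `α ↦ α - α(e) η` of the dual space onto the annihilator of `e`, where
`η(e) = 1`. -/
noncomputable def annProj {e : V} {η : Dual F V} (h : η e = 1) :
    Dual F V →ₗ[F] Submodule.dualAnnihilator (Submodule.span F {e}) :=
  LinearMap.codRestrict _ (LinearMap.id - (Dual.eval F V e).smulRight η) fun α => by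
    simp [Submodule.mem_dualAnnihilator, Submodule.mem_span_singleton, h, mul_comm]

lemma coe_annProj {e : V} {η : Dual F V} (h : η e = 1) (α : Dual F V) :
    (annProj h α : Dual F V) = α - α e • η := rfl

/-- The component of a form in the exterior power of the annihilator of `e`, with respect to the
decomposition of the dual space into this annihilator and the line of `η`. -/
noncomputable def annPart {e : V} {η : Dual F V} (h : η e = 1) {k : ℕ} (χ : Form F V k) :
    ⋀[F]^k (Submodule.dualAnnihilator (Submodule.span F {e})) :=
  exteriorPower.map k (annProj h) χ

lemma annForm_annPart {e : V} {η : Dual F V} (h : η e = 1) {k : ℕ} (χ : Form F V k) :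
    annForm (annPart h χ) =
      exteriorPower.map k (LinearMap.id - η.smulRight e : V →ₗ[F] V).dualMap χ := by
  have hproj : (Submodule.subtype _) ∘ₗ annProj h =
      (LinearMap.id - η.smulRight e : V →ₗ[F] V).dualMap := by
    ext α x
    simp [coe_annProj, mul_comm]
  rw [← hproj]
  exact (LinearMap.congr_fun (exteriorPower.map_comp (n := k) _ _) χ).symm

end FormEval

section Closed

variable {F L : Type*} [Field F] [LieRing L] [LieAlgebra F L]

lemma isClosedForm_smul_iff {k : ℕ} {c : F} (hc : c ≠ 0) (χ : Form F L (k + 1)) :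
    IsClosedForm (c • χ) ↔ IsClosedForm χ := by
  have hlie : ∀ x : Fin (k + 2) → L, lieD (c • χ) x = c * lieD χ x := fun x => by
    simp only [lieD, formEval, map_smul, AlternatingMap.smul_apply, smul_eq_mul, Finset.mul_sum,
      mul_ite, mul_zero, mul_left_comm c]
  simp only [IsClosedForm, hlie, mul_eq_zero, hc, false_or]

lemma exists_dual_ker_eq_of_lieIdeal [FiniteDimensional F L] {U : LieIdeal F L}
    (hU : finrank F U + 1 = finrank F L) {e : L} (he : e ∉ U) :
    ∃ η : Dual F L, η e = 1 ∧ LinearMap.ker η = U.toSubmodule := by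
  obtain ⟨f, hfe, hUf⟩ := Submodule.exists_le_ker_of_notMem (p := U.toSubmodule) he
  have hker : LinearMap.ker f = U.toSubmodule := by
    refine (Submodule.eq_of_le_of_finrank_le hUf ?_).symm
    have hrank := Module.Dual.finrank_ker_add_one_of_ne_zero (f := f) fun h => hfe (by simp [h])
    exact (Nat.succ_injective (hrank.trans hU.symm)).le
  exact ⟨(f e)⁻¹ • f, by simp [hfe], by rw [LinearMap.ker_smul _ _ (inv_ne_zero hfe), hker]⟩

lemma sub_smul_mem_of_ker_eq {U : Submodule F L} {e : L} {η : Dual F L} (he : η e = 1)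
    (hker : LinearMap.ker η = U) (x : L) : x - η x • e ∈ U := by
  rw [← hker]
  simp [he]

lemma lie_eq_smul_ad_sub_smul_ad {U : LieIdeal F L} [IsLieAbelian U] {e : L} {η : Dual F L}
    (he : η e = 1) (hker : LinearMap.ker η = U.toSubmodule) (x y : L) :
    ⁅x, y⁆ = η x • LieAlgebra.ad F L e y - η y • LieAlgebra.ad F L e x := by
  have hmem := sub_smul_mem_of_ker_eq he hker
  have habelian : ⁅x - η x • e, y - η y • e⁆ = 0 :=
    congrArg Subtype.val (trivial_lie_zero U U ⟨_, hmem x⟩ ⟨_, hmem y⟩)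
  simp only [sub_lie, lie_sub, smul_lie, lie_smul, lie_self, smul_zero, sub_zero] at habelian
  rw [← lie_skew x e, smul_neg, sub_neg_eq_add, sub_add, sub_eq_zero] at habelian
  exact habelian

lemma apply_ad_eq_zero {U : LieIdeal F L} {e : L} {η : Dual F L} (he : η e = 1)
    (hker : LinearMap.ker η = U.toSubmodule) (x : L) : η (LieAlgebra.ad F L e x) = 0 := by
  have hlie : ⁅e, x - η x • e⁆ ∈ LinearMap.ker η := hker ▸
    lie_mem_right F L U _ _ (sub_smul_mem_of_ker_eq he hker x)
  simpa using hlie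

variable {e : L} {η : Dual F L} {D : L →ₗ[F] L}

lemma lieD_annForm_annPart (h : η e = 1) (hη : ∀ x, η (D x) = 0)
    (hD : ∀ x y, ⁅x, y⁆ = η x • D y - η y • D x) (χ : Form F L (3 + 1)) (x : Fin 5 → L) :
    lieD (annForm (annPart h χ)) x = lieD χ x := by
  have hbracket : ∀ y z : L, ⁅y, z⁆ - η ⁅y, z⁆ • e = ⁅y, z⁆ := fun y z => by simp [hD, hη]
  let B (w : L) : L [⋀^Fin 3]→ₗ[F] F := (formEval χ).curryLeft w
  have hB : ∀ y z : L, B ⁅y, z⁆ = η y • B (D z) - η z • B (D y) := fun y z => by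
    simp only [B, hD, map_sub, map_smul]
  obtain ⟨G, hG⟩ : ∃ G : L → L → L → F,
      ∀ w (v : Fin 2 → L), B w (Matrix.vecCons e v) = G w (v 0) (v 1) :=
    ⟨fun w a b => B w ![e, a, b], fun w v =>
      congrArg (fun u => B w (Matrix.vecCons e u)) (List.ofFn_inj.1 rfl)⟩
  have hcorr : ∀ (y z : L) (v : Fin 3 → L),
      formEval (annForm (annPart h χ)) (Matrix.vecCons ⁅y, z⁆ v) =
        formEval χ (Matrix.vecCons ⁅y, z⁆ v) + ∑ p : Fin 3, (-1) ^ (p : ℕ) • (-η (v p)) •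
          (η y • G (D z) (p.removeNth v 0) (p.removeNth v 1)
            - η z • G (D y) (p.removeNth v 0) (p.removeNth v 1)) := fun y z v => by
    have harg : (fun i => (LinearMap.id - η.smulRight e : L →ₗ[F] L) (Matrix.vecCons ⁅y, z⁆ v i)) =
        Matrix.vecCons ⁅y, z⁆ fun p => v p + -η (v p) • e := by
      funext i
      refine Fin.cases (hbracket y z) (fun p => ?_) i
      simp [sub_eq_add_neg]
    simp_rw [annForm_annPart, formEval_map_dualMap, harg, ← AlternatingMap.curryLeft_apply_apply,
      ← hG]
    refine (alternatingMap_add_smul (B ⁅y, z⁆) v _ e).trans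
      (congrArg₂ _ rfl (Finset.sum_congr rfl fun p _ => ?_))
    rw [hB]
    rfl
  -- The terms with `η (x i) * η (x j)` occur in pairs of opposite signs.
  simp only [lieD, hcorr]
  simp [Fin.sum_univ_succ, Fin.removeNth_apply, Fin.succAbove]
  ring

lemma isClosedForm_annForm_annPart_iff (h : η e = 1) (hη : ∀ x, η (D x) = 0)
    (hD : ∀ x y, ⁅x, y⁆ = η x • D y - η y • D x) (χ : Form F L (3 + 1)) :
    IsClosedForm (annForm (annPart h χ)) ↔ IsClosedForm χ :=
  forall_congr' fun x => by rw [lieD_annForm_annPart h hη hD]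

end Closed

/-! ### Normal form of alternating bilinear forms -/

section AlternatingBilinear

/-- The Gram matrix of the standard alternating bilinear form of rank `2 r`: the basis vectors
`0, 1`, then `2, 3` and so on form `r` hyperbolic pairs, and the others span the radical. -/
def stdAlt : ℕ → ℕ → ℕ → ℤ
  | _ + 1, 0, 1 => 1
  | _ + 1, 1, 0 => -1
  | r + 1, i + 2, j + 2 => stdAlt r i j
  | _, _, _ => 0

variable {F : Type*} [Field F]

lemma linearIndependent_cons_cons {W : Type*} [AddCommGroup W] [Module F W]
    {B : LinearMap.BilinForm F W} (hB : B.IsAlt) {x y : W} (hxy : B x y ≠ 0) {m : ℕ}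
    {f : Fin m → W} (hf : LinearIndependent F f) (hx : ∀ i, B x (f i) = 0)
    (hy : ∀ i, B y (f i) = 0) :
    LinearIndependent F (Fin.cons x (Fin.cons y f : Fin (m + 1) → W) : Fin (m + 2) → W) := by
  refine linearIndependent_finCons.2 ⟨linearIndependent_finCons.2 ⟨hf, fun hmem => hxy ?_⟩,
    fun hmem => hxy ?_⟩
  · have hspan : Submodule.span F (Set.range f) ≤ LinearMap.ker (B x) :=
      Submodule.span_le.2 (Set.range_subset_iff.2 hx)
    exact hspan hmem
  · have hspan : Submodule.span F (Set.range (Fin.cons y f : Fin (m + 1) → W)) ≤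
        LinearMap.ker (B y) :=
      Submodule.span_le.2 (Set.range_subset_iff.2 (Fin.cases (hB y) hy))
    rw [← hB.neg_eq, LinearMap.mem_ker.1 (hspan hmem), neg_zero]

lemma finrank_ker_prod_add_two {W : Type*} [AddCommGroup W] [Module F W] [FiniteDimensional F W]
    {B : LinearMap.BilinForm F W} (hB : B.IsAlt) {x y : W} (hxy : B x y = 1) :
    finrank F (LinearMap.ker ((B x).prod (B y))) + 2 = finrank F W := by
  have hsurj : Function.Surjective ((B x).prod (B y)) := fun p =>
    ⟨p.1 • y - p.2 • x, by simp [hB.self_eq_zero, hxy, ← hB.neg_eq x y]⟩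
  rw [← LinearMap.finrank_range_add_finrank_ker ((B x).prod (B y)),
    LinearMap.range_eq_top.2 hsurj, finrank_top, finrank_prod, finrank_self, add_comm]

lemma exists_basis_eq_stdAlt (n : ℕ) : ∀ {W : Type*} [AddCommGroup W] [Module F W]
    [FiniteDimensional F W] (_ : finrank F W = n) {B : LinearMap.BilinForm F W} (_ : B.IsAlt),
    ∃ r, 2 * r ≤ n ∧ ∃ f : Basis (Fin n) F W, ∀ i j, B (f i) (f j) = (stdAlt r i j : F) := by
  induction n using Nat.strong_induction_on with
  | _ n ih =>
  intro W _ _ _ hW B hB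
  by_cases h0 : B = 0
  · exact ⟨0, by simp, finBasisOfFinrankEq F W hW, by simp [h0, stdAlt]⟩
  obtain ⟨x, y, hxy⟩ : ∃ x y, B x y = 1 := by
    by_contra! h
    refine h0 (LinearMap.ext₂ fun x y => not_not.1 fun hne => h x ((B x y)⁻¹ • y) ?_)
    rw [map_smul, smul_eq_mul, inv_mul_cancel₀ hne]
  have hdim := finrank_ker_prod_add_two hB hxy
  obtain ⟨m, rfl⟩ : ∃ m, n = m + 2 := ⟨n - 2, by omega⟩
  obtain ⟨r, hr, f, hf⟩ := ih m (by omega) (by omega)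
    (B := B.restrict (LinearMap.ker ((B x).prod (B y)))) fun z => hB z
  have hker : ∀ i, B x (f i) = 0 ∧ B y (f i) = 0 := fun i =>
    Prod.mk.inj (LinearMap.mem_ker.1 (f i).2)
  have hli := linearIndependent_cons_cons hB (hxy ▸ one_ne_zero)
    (f.linearIndependent.map' (Submodule.subtype _) (Submodule.ker_subtype _))
    (fun i => (hker i).1) fun i => (hker i).2
  refine ⟨r + 1, by omega, basisOfLinearIndependentOfCardEqFinrank hli (by simp [hW]), ?_⟩
  rw [coe_basisOfLinearIndependentOfCardEqFinrank]
  intro i j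
  refine Fin.cases ?_ (Fin.cases ?_ fun i => ?_) i <;>
    refine Fin.cases ?_ (Fin.cases ?_ fun j => ?_) j
  · simp [stdAlt, hB.self_eq_zero]
  · simp [stdAlt, hxy]
  · simpa [stdAlt] using (hker j).1
  · simp [stdAlt, ← hB.neg_eq x y, hxy]
  · simp [stdAlt, hB.self_eq_zero]
  · simpa [stdAlt] using (hker j).2
  · simpa [stdAlt, ← hB.neg_eq x] using (hker i).1
  · simpa [stdAlt, ← hB.neg_eq y] using (hker i).2
  · simpa [stdAlt] using hf i j

end AlternatingBilinear

/-! ### Normal form of four-vectors in dimension six -/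

section Euler

variable {R W ι' : Type*} [CommRing R] [AddCommGroup W] [Module R W] [Fintype ι']

lemma sum_ι_mul_contractLeft_ιMulti (b : Basis ι' R W) {k : ℕ} (v : Fin k → W) :
    ∑ i, ι R (b i) * CliffordAlgebra.contractLeft (b.coord i) (ExteriorAlgebra.ιMulti R k v) =
      (k : R) • ExteriorAlgebra.ιMulti R k v := by
  induction k with
  | zero => simp
  | succ k ih =>
    set X := ExteriorAlgebra.ιMulti R k (Matrix.vecTail v)
    have hterm : ∀ i, ι R (b i) * CliffordAlgebra.contractLeft (b.coord i) (ι R (v 0) * X) =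
        ι R (b.repr (v 0) i • b i) * X +
          ι R (v 0) * (ι R (b i) * CliffordAlgebra.contractLeft (b.coord i) X) := fun i => by
      rw [CliffordAlgebra.contractLeft_ι_mul, mul_sub, mul_smul_comm, ← smul_mul_assoc, ← map_smul,
        ← mul_assoc, eq_neg_of_add_eq_zero_left (ι_add_mul_swap (b i) (v 0)), neg_mul,
        sub_neg_eq_add, mul_assoc, b.coord_apply]
    rw [ιMulti_succ_apply, Finset.sum_congr rfl fun i _ => hterm i, Finset.sum_add_distrib,
      ← Finset.sum_mul, ← Finset.mul_sum, ih, ← map_sum, b.sum_repr]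
    rw [mul_smul_comm, Nat.cast_succ, add_smul, one_smul, add_comm]

lemma sum_ι_mul_contractLeft (b : Basis ι' R W) {k : ℕ} (X : ⋀[R]^k W) :
    ∑ i, ι R (b i) * CliffordAlgebra.contractLeft (b.coord i) (X : ExteriorAlgebra R W) =
      (k : R) • (X : ExteriorAlgebra R W) := by
  have hEuler : (∑ i, LinearMap.mulLeft R (ι R (b i)) ∘ₗ
      CliffordAlgebra.contractLeft (b.coord i)) ∘ₗ (⋀[R]^k W).subtype =
        (k : R) • (⋀[R]^k W).subtype :=
    exteriorPower.linearMap_ext <| AlternatingMap.ext fun v => by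
      simpa using sum_ι_mul_contractLeft_ιMulti b v
  simpa using LinearMap.congr_fun hEuler X

lemma sum_contractLeft_ι_mul (b : Basis ι' R W) {k : ℕ} (X : ⋀[R]^k W) :
    ∑ i, CliffordAlgebra.contractLeft (b.coord i) (ι R (b i) * (X : ExteriorAlgebra R W)) =
      (Fintype.card ι' - k : R) • (X : ExteriorAlgebra R W) := by
  simp [CliffordAlgebra.contractLeft_ι_mul, sum_ι_mul_contractLeft, sub_smul,
    Nat.cast_smul_eq_nsmul]

end Euler

section Field

variable {F W : Type*} [Field F] [AddCommGroup W] [Module F W]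

lemma ι_mul_mem_exteriorPower {k : ℕ} (x : W) {X : ExteriorAlgebra F W} (hX : X ∈ ⋀[F]^k W) :
    ι F x * X ∈ ⋀[F]^(k + 1) W := by
  rw [exteriorPower, pow_succ']
  exact Submodule.mul_mem_mul (LinearMap.mem_range_self _ _) hX

lemma eq_zero_of_forall_ι_mul_eq_zero {n k : ℕ} (hnk : (n : F) ≠ k) (b : Basis (Fin n) F W)
    {X : ⋀[F]^k W} (hX : ∀ i, ι F (b i) * (X : ExteriorAlgebra F W) = 0) : X = 0 := by
  have hsum := sum_contractLeft_ι_mul b X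
  simp only [hX, map_zero, Finset.sum_const_zero, Fintype.card_fin] at hsum
  exact Submodule.coe_eq_zero.1 ((smul_eq_zero.1 hsum.symm).resolve_left (sub_ne_zero.2 hnk))

lemma eq_of_forall_ι_mul_ι_mul_eq {n k : ℕ} (hnk : (n : F) ≠ k) (hnk' : (n : F) ≠ (k + 1 : ℕ))
    (b : Basis (Fin n) F W) {X Y : ⋀[F]^k W}
    (hXY : ∀ i j, ι F (b i) * (ι F (b j) * (X : ExteriorAlgebra F W)) =
      ι F (b i) * (ι F (b j) * (Y : ExteriorAlgebra F W))) : X = Y := by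
  refine sub_eq_zero.1 (eq_zero_of_forall_ι_mul_eq_zero hnk b fun j => ?_)
  refine Submodule.coe_eq_zero.2 (eq_zero_of_forall_ι_mul_eq_zero hnk' b
    (X := ⟨_, ι_mul_mem_exteriorPower (b j) (X - Y).2⟩) fun i => ?_)
  change ι F (b i) * (ι F (b j) * ((X : ExteriorAlgebra F W) - Y)) = 0
  rw [mul_sub, mul_sub, hXY, sub_self]

/-- The coefficient of the top degree part of an element of the exterior algebra. -/
noncomputable def topCoeff {n : ℕ} (b : Basis (Fin n) F W) : ExteriorAlgebra F W →ₗ[F] F :=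
  liftAlternating (Pi.single n b.det)

lemma topCoeff_ιMulti {n : ℕ} (b : Basis (Fin n) F W) (v : Fin n → W) :
    topCoeff b (ExteriorAlgebra.ιMulti F n v) = b.det v := by
  rw [topCoeff, liftAlternating_apply_ιMulti, Pi.single_eq_same]

lemma eq_topCoeff_smul_ιMulti {n : ℕ} (b : Basis (Fin n) F W) {X : ExteriorAlgebra F W}
    (hX : X ∈ ⋀[F]^n W) : X = topCoeff b X • ExteriorAlgebra.ιMulti F n b := by
  have hid : (⋀[F]^n W).subtype = (topCoeff b ∘ₗ (⋀[F]^n W).subtype).smulRight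
      (ExteriorAlgebra.ιMulti F n b) := by
    refine exteriorPower.linearMap_ext (Basis.ext_alternating b fun v hv => ?_)
    let σ : Equiv.Perm (Fin n) := Equiv.ofBijective v (Finite.injective_iff_bijective.1 hv)
    change ExteriorAlgebra.ιMulti F n (b ∘ σ) =
      topCoeff b (ExteriorAlgebra.ιMulti F n (b ∘ σ)) • ExteriorAlgebra.ιMulti F n b
    rw [topCoeff_ιMulti, AlternatingMap.map_perm, AlternatingMap.map_perm, b.det_self, smul_assoc,
      one_smul]
  exact LinearMap.congr_fun hid ⟨X, hX⟩

/-- The basis vectors that occur in the complement of the `i`-th pair of a basis of six vectors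
`f 0, f 1 | f 2, f 3 | f 4, f 5`. -/
def complementBlock : ℕ → Fin 4 → Fin 6
  | 0 => ![2, 3, 4, 5]
  | 1 => ![0, 1, 4, 5]
  | _ => ![0, 1, 2, 3]

/-- The normal form of the four-vectors of length `r ≤ 3` on a space with the basis `f`. -/
noncomputable def standardFour (f : Fin 6 → W) (r : ℕ) : ⋀[F]^4 W :=
  ∑ i : Fin r, exteriorPower.ιMulti F 4 (f ∘ complementBlock i)

/-- `standardFour` as a combination of words. -/
def standardFourWords (r : ℕ) : WordSum 6 :=
  List.ofFn fun i : Fin r => (1, List.ofFn (complementBlock i))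

lemma coe_standardFour (f : Fin 6 → W) (r : ℕ) :
    (standardFour f r : ⋀[F]^4 W) = (standardFourWords r).eval F f := by
  simp only [standardFour, AddSubmonoidClass.coe_finsetSum, WordSum.coe_ιMulti, WordSum.eval,
    standardFourWords, List.map_ofFn, List.sum_ofFn, Function.comp_apply, one_smul]

lemma mul_standardFourWords (r : Fin 4) (i j : Fin 6) :
    WordSum.equiv (WordSum.mul [(1, [i, j])] (standardFourWords r))
      [(stdAlt r i j, [0, 1, 2, 3, 4, 5])] = true := by
  decide +kernel +revert

lemma ι_mul_ι_mul_standardFour (f : Fin 6 → W) {r : ℕ} (hr : r ≤ 3) (i j : Fin 6) :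
    ι F (f i) * (ι F (f j) * ((standardFour f r : ⋀[F]^4 W) : ExteriorAlgebra F W)) =
      (stdAlt r i j : F) • ExteriorAlgebra.ιMulti F 6 f := by
  have hwords := WordSum.eval_eq_of_equiv F (f := f)
    (mul_standardFourWords ⟨r, Nat.lt_succ_of_le hr⟩ i j)
  have hvol : ExteriorAlgebra.ιMulti F 6 f = WordSum.wordProd F f [0, 1, 2, 3, 4, 5] :=
    WordSum.coe_ιMulti F f id
  simpa only [WordSum.eval_mul, WordSum.eval_cons, WordSum.eval_nil, WordSum.wordProd_cons,
    WordSum.wordProd_nil, ← hvol, ← coe_standardFour, mul_assoc, one_smul, add_zero, one_mul,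
    Int.cast_smul_eq_zsmul] using hwords

lemma exists_eq_smul_standardFour [NeZero (2 : F)] (hW : finrank F W = 6) (Ω : ⋀[F]^4 W) :
    ∃ r ≤ 3, ∃ (f : Basis (Fin 6) F W) (c : F), c ≠ 0 ∧ Ω = c • standardFour f r := by
  have : FiniteDimensional F W := FiniteDimensional.of_finrank_pos (by omega)
  let w : Basis (Fin 6) F W := finBasisOfFinrankEq F W hW
  let B : LinearMap.BilinForm F W := LinearMap.mk₂ F
    (fun x y => topCoeff w (ι F x * (ι F y * (Ω : ExteriorAlgebra F W))))
    (fun _ _ _ => by simp [add_mul]) (fun _ _ _ => by simp)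
    (fun _ _ _ => by simp [mul_add, add_mul]) (fun _ _ _ => by simp)
  have hB : B.IsAlt := fun x => by simp [B, ← mul_assoc]
  obtain ⟨r, hr, f, hf⟩ := exists_basis_eq_stdAlt 6 hW hB
  have hd : w.det f ≠ 0 := (w.isUnit_det f).ne_zero
  have hf_top : ExteriorAlgebra.ιMulti F 6 f = w.det f • ExteriorAlgebra.ιMulti F 6 w := by
    rw [← topCoeff_ιMulti]
    exact eq_topCoeff_smul_ιMulti w (exteriorPower.ιMulti F 6 f).2
  refine ⟨r, by omega, f, (w.det f)⁻¹, inv_ne_zero hd,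
    eq_of_forall_ι_mul_ι_mul_eq ?_ ?_ f fun i j => ?_⟩
  · rw [← sub_ne_zero]
    convert NeZero.ne (2 : F) using 1
    norm_num
  · rw [← sub_ne_zero]
    norm_num
  · have hmem := ι_mul_mem_exteriorPower (f i) (ι_mul_mem_exteriorPower (f j) Ω.2)
    rw [eq_topCoeff_smul_ιMulti w hmem, Submodule.coe_smul, mul_smul_comm, mul_smul_comm,
      ι_mul_ι_mul_standardFour f (by omega), hf_top,
      smul_comm (stdAlt r i j : F), inv_smul_smul₀ hd, ← hf i j]
    rfl

end Field

/-! ### The length of multivectors -/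

section Length

variable {F W : Type*} [Field F] [AddCommGroup W] [Module F W]

lemma kLength_le {k l : ℕ} {X : ⋀[F]^k W} (v : Fin l → Fin k → W)
    (hv : X = ∑ i, exteriorPower.ιMulti F k (v i)) : kLength X ≤ l :=
  Nat.sInf_le ⟨v, hv⟩

lemma exists_ιMulti_eq_smul {k : ℕ} (c : F) (v : Fin (k + 1) → W) :
    ∃ w, exteriorPower.ιMulti F (k + 1) w = c • exteriorPower.ιMulti F (k + 1) v :=
  ⟨Function.update v 0 (c • v 0), by rw [AlternatingMap.map_update_smul, Function.update_eq_self]⟩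

lemma exists_eq_sum_ιMulti {k : ℕ} (X : ⋀[F]^(k + 1) W) :
    ∃ (l : ℕ) (v : Fin l → Fin (k + 1) → W), X = ∑ i, exteriorPower.ιMulti F (k + 1) (v i) := by
  have hX : X ∈ Submodule.span F (Set.range (exteriorPower.ιMulti F (k + 1) (M := W))) := by
    rw [exteriorPower.ιMulti_span]
    exact Submodule.mem_top
  induction hX using Submodule.span_induction with
  | mem X hX =>
    obtain ⟨v, rfl⟩ := hX
    exact ⟨1, fun _ => v, by simp⟩
  | zero => exact ⟨0, Fin.elim0, by simp⟩
  | add X Y _ _ hX hY =>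
    obtain ⟨l, v, rfl⟩ := hX
    obtain ⟨m, w, rfl⟩ := hY
    exact ⟨l + m, Fin.append v w, by simp [Fin.sum_univ_add]⟩
  | smul c X _ hX =>
    obtain ⟨l, v, rfl⟩ := hX
    choose w hw using fun i => exists_ιMulti_eq_smul c (v i)
    exact ⟨l, w, by simp only [hw, Finset.smul_sum]⟩

lemma exists_eq_sum_kLength {k : ℕ} (X : ⋀[F]^(k + 1) W) :
    ∃ v : Fin (kLength X) → Fin (k + 1) → W, X = ∑ i, exteriorPower.ιMulti F (k + 1) (v i) :=
  Nat.sInf_mem (exists_eq_sum_ιMulti X)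

lemma kLength_smul_standardFour_le (c : F) (f : Fin 6 → W) (r : ℕ) :
    kLength (c • standardFour (F := F) f r) ≤ r := by
  choose w hw using fun i : Fin r => exists_ιMulti_eq_smul c (f ∘ complementBlock i)
  exact kLength_le w (by rw [standardFour, Finset.smul_sum, Finset.sum_congr rfl fun i _ => hw i])

/-- The vectors `x` with `x ∧ X = 0`. Its dimension bounds the length of `X` from below. -/
def wedgeKernel (X : ExteriorAlgebra F W) : Submodule F W :=
  LinearMap.ker (LinearMap.mulRight F X ∘ₗ ι F)

lemma mem_wedgeKernel {X : ExteriorAlgebra F W} {x : W} : x ∈ wedgeKernel X ↔ ι F x * X = 0 :=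
  Iff.rfl

lemma wedgeKernel_zero : wedgeKernel (0 : ExteriorAlgebra F W) = ⊤ := by
  simp [wedgeKernel]

variable [FiniteDimensional F W]

lemma finrank_wedgeKernel_add_finrank_wedgeKernel_le (X Y : ExteriorAlgebra F W) :
    finrank F (wedgeKernel X) + finrank F (wedgeKernel Y) ≤
      finrank F W + finrank F (wedgeKernel (X + Y)) := by
  have hinf : wedgeKernel X ⊓ wedgeKernel Y ≤ wedgeKernel (X + Y) := fun x ⟨hX, hY⟩ => by
    rw [mem_wedgeKernel, mul_add, mem_wedgeKernel.1 hX, mem_wedgeKernel.1 hY, add_zero]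
  rw [← Submodule.finrank_sup_add_finrank_inf_eq]
  exact add_le_add (Submodule.finrank_le _) (Submodule.finrank_mono hinf)

lemma finrank_le_finrank_wedgeKernel_ιMulti {k : ℕ} (u : Fin k → W) :
    finrank F W ≤
      finrank F (wedgeKernel (ExteriorAlgebra.ιMulti F k u)) + (finrank F W - k) := by
  by_cases hu : LinearIndependent F u
  · have hle : Submodule.span F (Set.range u) ≤ wedgeKernel (ExteriorAlgebra.ιMulti F k u) := by
      rw [Submodule.span_le]
      rintro _ ⟨i, rfl⟩
      have hcons : ι F (u i) * ExteriorAlgebra.ιMulti F k u =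
          ExteriorAlgebra.ιMulti F (k + 1) (Matrix.vecCons (u i) u) := by
        simp [ιMulti_succ_apply]
      rw [SetLike.mem_coe, mem_wedgeKernel, hcons]
      exact AlternatingMap.map_eq_zero_of_eq _ _ (i := 0) (j := i.succ) rfl i.succ_ne_zero.symm
    have hspan := Submodule.finrank_mono hle
    rw [finrank_span_eq_card hu, Fintype.card_fin] at hspan
    omega
  · rw [AlternatingMap.map_linearDependent _ _ hu, wedgeKernel_zero, finrank_top]
    exact Nat.le_add_right _ _

lemma finrank_le_finrank_wedgeKernel_sum {k : ℕ} (l : ℕ) (u : Fin l → Fin k → W) :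
    finrank F W ≤ finrank F (wedgeKernel (∑ i, ExteriorAlgebra.ιMulti F k (u i))) +
      l * (finrank F W - k) := by
  induction l with
  | zero =>
    rw [Fin.sum_univ_zero, wedgeKernel_zero, finrank_top]
    exact Nat.le_add_right _ _
  | succ l ih =>
    have hinit := ih fun i => u i.castSucc
    have hlast := finrank_le_finrank_wedgeKernel_ιMulti (F := F) (u (Fin.last l))
    have hadd := finrank_wedgeKernel_add_finrank_wedgeKernel_le
      (∑ i : Fin l, ExteriorAlgebra.ιMulti F k (u i.castSucc))
      (ExteriorAlgebra.ιMulti F k (u (Fin.last l)))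
    rw [← Fin.sum_univ_castSucc fun i => ExteriorAlgebra.ιMulti F k (u i)] at hadd
    rw [add_one_mul]
    omega

end Length

/-! ### The cross product on one-forms -/

section Cross

variable {R : Type*} [CommRing R] (ε : ℤˣ)

/-- The cross product of `φ_ε` in the coordinates of an adapted basis, i.e.
`g(x × y, z) = φ_ε(x, y, z)` for the metric `g` induced by `φ_ε`. -/
def cross : (Fin 7 → R) →ₗ[R] (Fin 7 → R) →ₗ[R] (Fin 7 → R) :=
  LinearMap.mk₂ R (fun x y =>
    let p : Fin 7 → Fin 7 → R := fun i j => x i * y j - x j * y i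
    let s : R := (ε : ℤ)
    ![p 1 6 + s * (p 2 4 - p 3 5), -p 0 6 - s * (p 2 5 + p 3 4), p 3 6 - s * (p 0 4 - p 1 5),
      -p 2 6 + s * (p 0 5 + p 1 4), p 5 6 + p 0 2 - p 1 3, -p 4 6 - p 0 3 - p 1 2,
      p 4 5 + s * (p 0 1 + p 2 3)])
    (fun _ _ _ => by ext k; fin_cases k <;> simp <;> ring)
    (fun _ _ _ => by ext k; fin_cases k <;> simp <;> ring)
    (fun _ _ _ => by ext k; fin_cases k <;> simp <;> ring)
    (fun _ _ _ => by ext k; fin_cases k <;> simp <;> ring)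

lemma neg_cross (x y : Fin 7 → R) : -cross ε y x = cross ε x y := by
  ext k
  fin_cases k <;> simp [cross] <;> ring

lemma cross_cross_self (x y : Fin 7 → R) :
    cross ε x (cross ε x y) =
      (∑ i, ((metricSign ε i : ℤ) : R) * (x i * y i)) • x -
        (∑ i, ((metricSign ε i : ℤ) : R) * (x i * x i)) • y := by
  ext k
  rcases Int.units_eq_one_or ε with rfl | rfl <;>
    fin_cases k <;> simp [cross, metricSign, Fin.sum_univ_succ] <;> ring

@[simp] lemma intCast_cross (x y : Fin 7 → ℤ) (k : Fin 7) :
    ((cross ε x y k : ℤ) : R) = cross ε (fun i => (x i : R)) (fun i => (y i : R)) k := by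
  fin_cases k <;> simp [cross]

lemma mul_starWords (i j k : Fin 7) :
    WordSum.equiv (WordSum.mul [(1, [k, i, j])] (starWords ε)) (volWords.smul
      (metricSign ε k * cross ε (Pi.single i 1) (Pi.single j 1) k)) = true := by
  decide +kernel +revert

end Cross

section WedgeKernel

variable {F V : Type*} [Field F] [AddCommGroup V] [Module F V] (ε : ℤˣ) (b : Basis (Fin 7) F V)

lemma ι_coord_mul_ι_mul_ι_mul_starForm (x y : Dual F V) (k : Fin 7) :
    ι F (b.coord k) * (ι F x * (ι F y * (starForm ε b : ExteriorAlgebra F (Dual F V)))) =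
      (((metricSign ε k : ℤ) : F) * cross ε (x ∘ b) (y ∘ b) k) •
        (volForm b : ExteriorAlgebra F (Dual F V)) := by
  have hsingle : ∀ i j, ι F (b.coord k) * (ι F (b.coord i) * (ι F (b.coord j) *
      (starForm ε b : ExteriorAlgebra F (Dual F V)))) =
        (((metricSign ε k : ℤ) : F) * cross ε (Pi.single i 1) (Pi.single j 1) k) •
          (volForm b : ExteriorAlgebra F (Dual F V)) := fun i j => by
    have hcast (i : Fin 7) : (fun l => ((Pi.single i 1 : Fin 7 → ℤ) l : F)) = Pi.single i 1 := by
      ext l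
      simp [Pi.single_apply]
    have hwords := WordSum.eval_eq_of_equiv F (f := b.coord) (mul_starWords ε i j k)
    simpa [WordSum.eval_mul, WordSum.eval_smul, ← coe_starForm, ← coe_volForm, mul_assoc,
      ← Int.cast_smul_eq_zsmul F, hcast] using hwords
  have hcoord : ∀ x : Dual F V, x ∘ b = ∑ i, x (b i) • Pi.single i 1 := fun x => by
    ext i
    simp [Finset.sum_apply, Pi.single_apply]
  conv_lhs => rw [← b.sum_dual_apply_smul_coord x, ← b.sum_dual_apply_smul_coord y]
  rw [hcoord x, hcoord y]
  simp only [map_sum, map_smul, Finset.sum_mul, Finset.mul_sum, smul_mul_assoc, mul_smul_comm,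
    hsingle, LinearMap.sum_apply, LinearMap.smul_apply, Finset.sum_apply, Pi.smul_apply,
    Finset.sum_smul, smul_smul, Finset.smul_sum, smul_eq_mul]
  exact Finset.sum_congr rfl fun i _ => Finset.sum_congr rfl fun j _ => by congr 1; ring

variable {ε b} {x η : Dual F V}

lemma cross_eq_zero_of_mem_wedgeKernel
    (hx : x ∈ wedgeKernel (ι F η * (starForm ε b : ExteriorAlgebra F (Dual F V)))) :
    cross ε (x ∘ b) (η ∘ b) = 0 := by
  ext k
  have hk := ι_coord_mul_ι_mul_ι_mul_starForm ε b x η k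
  rw [mem_wedgeKernel.1 hx, mul_zero, eq_comm, smul_eq_zero] at hk
  have hvol : (volForm b : ExteriorAlgebra F (Dual F V)) ≠ 0 :=
    fun h => volForm_ne_zero b (Submodule.coe_eq_zero.1 h)
  have hsign := left_ne_zero_of_mul_eq_one (metricSign_mul_self (F := F) ε k)
  simpa using (mul_eq_zero.1 (hk.resolve_right hvol)).resolve_left hsign

lemma metric_dualBasis_apply (x y : Dual F V) :
    metric ε b.dualBasis x y = ∑ i, ((metricSign ε i : ℤ) : F) * (x (b i) * y (b i)) := by
  simp [metric_apply]

lemma metric_smul_eq_of_cross_eq_zero (hxη : cross ε (x ∘ b) (η ∘ b) = 0) :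
    metric ε b.dualBasis x x • η = metric ε b.dualBasis x η • x := by
  have hcross := cross_cross_self ε (x ∘ b) (η ∘ b)
  rw [hxη, map_zero, eq_comm, sub_eq_zero] at hcross
  refine b.ext fun i => ?_
  simpa [metric_dualBasis_apply] using (congrFun hcross i).symm

lemma finrank_wedgeKernel_ι_mul_starForm_le_one (hη : metric ε b.dualBasis η η ≠ 0) :
    finrank F (wedgeKernel (ι F η * (starForm ε b : ExteriorAlgebra F (Dual F V)))) ≤ 1 := by
  have := Module.Finite.of_basis b
  refine (Submodule.finrank_mono (t := F ∙ η) fun x hx => ?_).trans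
    (by simpa using finrank_span_le_card (R := F) ({η} : Set (Dual F V)))
  have hcross : cross ε (η ∘ b) (x ∘ b) = 0 := by
    rw [← neg_cross, cross_eq_zero_of_mem_wedgeKernel hx, neg_zero]
  rw [← Submodule.smul_mem_iff _ hη, metric_smul_eq_of_cross_eq_zero hcross]
  exact Submodule.smul_mem _ _ (Submodule.mem_span_singleton_self η)

end WedgeKernel

section Isotropic

variable {F W : Type*} [Field F] [AddCommGroup W] [Module F W] [FiniteDimensional F W]

lemma two_mul_finrank_le_of_isotropic [NeZero (2 : F)] {B : LinearMap.BilinForm F W}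
    (hB : B.Nondegenerate) (hsymm : B.IsSymm) {K : Submodule F W} (hK : ∀ x ∈ K, B x x = 0) :
    2 * finrank F K ≤ finrank F W := by
  have hle : K ≤ B.orthogonal K := fun y hy x hx => by
    have hadd := hK _ (K.add_mem hx hy)
    simp only [map_add, LinearMap.add_apply, hK x hx, hK y hy, zero_add, add_zero,
      hsymm.eq y x, ← two_mul] at hadd
    exact (mul_eq_zero.1 hadd).resolve_left two_ne_zero
  have hdim := Submodule.finrank_mono hle
  rw [LinearMap.BilinForm.finrank_orthogonal hB] at hdim
  have := K.finrank_le
  omega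

end Isotropic

section Null

variable {F V : Type*} [Field F] [AddCommGroup V] [Module F V] {ε : ℤˣ} {b : Basis (Fin 7) F V}
  {η : Dual F V}

lemma finrank_wedgeKernel_ι_mul_starForm_le_three [NeZero (2 : F)] (hη : η ≠ 0) :
    finrank F (wedgeKernel (ι F η * (starForm ε b : ExteriorAlgebra F (Dual F V)))) ≤ 3 := by
  have := Module.Finite.of_basis b
  by_cases hnull : metric ε b.dualBasis η η = 0
  · have hiso : ∀ x ∈ wedgeKernel (ι F η * (starForm ε b : ExteriorAlgebra F (Dual F V))),
        metric ε b.dualBasis x x = 0 := fun x hx => by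
      have hcross := cross_eq_zero_of_mem_wedgeKernel hx
      have hcross' : cross ε (η ∘ b) (x ∘ b) = 0 := by rw [← neg_cross, hcross, neg_zero]
      have hηx := metric_smul_eq_of_cross_eq_zero hcross'
      rw [hnull, zero_smul, eq_comm, smul_eq_zero, or_iff_left hη] at hηx
      have hxx := metric_smul_eq_of_cross_eq_zero hcross
      rw [← (metric_isSymm ε b.dualBasis).eq η x, hηx] at hxx
      simpa [hη] using hxx
    have hdim := two_mul_finrank_le_of_isotropic (metric_nondegenerate ε b.dualBasis)
      (metric_isSymm ε b.dualBasis) hiso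
    rw [finrank_eq_card_basis b.dualBasis, Fintype.card_fin] at hdim
    omega
  · exact (finrank_wedgeKernel_ι_mul_starForm_le_one hnull).trans (by norm_num)

end Null

/-! ### The length of the Hodge dual on a hyperplane -/

section Restriction

variable {R M N : Type*} [CommRing R] [AddCommGroup M] [Module R M] [AddCommGroup N] [Module R N]

lemma coe_exteriorPower_map (P : M →ₗ[R] N) {k : ℕ} (X : ⋀[R]^k M) :
    (exteriorPower.map k P X : ExteriorAlgebra R N) = ExteriorAlgebra.map P X := by
  have hcomp : (⋀[R]^k N).subtype ∘ₗ exteriorPower.map k P =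
      (ExteriorAlgebra.map P).toLinearMap ∘ₗ (⋀[R]^k M).subtype :=
    exteriorPower.linearMap_ext (AlternatingMap.ext fun v =>
      (congrArg Subtype.val (exteriorPower.map_apply_ιMulti P v)).trans
        (ExteriorAlgebra.map_apply_ιMulti P v).symm)
  exact LinearMap.congr_fun hcomp X

lemma WordSum.map_eval {n : ℕ} (P : M →ₗ[R] N) (f : Fin n → M) (p : WordSum n) :
    ExteriorAlgebra.map P (WordSum.eval R f p) = WordSum.eval R (P ∘ f) p := by
  simp only [WordSum.eval, WordSum.wordProd, map_list_sum, List.map_map, Function.comp_def,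
    map_zsmul, map_list_prod, map_apply_ι]

lemma ι_mul_map_of_sub_mem_span {P : M →ₗ[R] M} {η : M} (hP : ∀ m, P m - m ∈ R ∙ η)
    (x : ExteriorAlgebra R M) : ι R η * ExteriorAlgebra.map P x = ι R η * x := by
  have hι (m : M) : ι R η * ι R (P m) = ι R η * ι R m := by
    obtain ⟨c, hc⟩ := Submodule.mem_span_singleton.1 (hP m)
    rw [← sub_eq_zero, ← mul_sub, ← map_sub, ← hc, map_smul, mul_smul_comm, ι_sq_zero, smul_zero]
  induction x using CliffordAlgebra.left_induction with
  | algebraMap r => rw [AlgHom.commutes]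
  | add x y hx hy => rw [map_add, mul_add, mul_add, hx, hy]
  | ι_mul x m hx =>
    have hswap (m : M) : ι R η * ι R m = -(ι R m * ι R η) :=
      eq_neg_of_add_eq_zero_left (ι_add_mul_swap η m)
    rw [map_mul, map_apply_ι, ← mul_assoc, hι, hswap, neg_mul, mul_assoc, hx, ← mul_assoc,
      ← neg_mul, ← hswap, mul_assoc]

end Restriction

section Length

variable {F V : Type*} [Field F] [AddCommGroup V] [Module F V] {e : V} {η : Dual F V}

lemma ι_mul_annForm_annPart (h : η e = 1) {k : ℕ} (χ : Form F V k) :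
    ι F η * (annForm (annPart h χ) : ExteriorAlgebra F (Dual F V)) = ι F η * χ := by
  rw [annForm_annPart, coe_exteriorPower_map, ι_mul_map_of_sub_mem_span fun α => ?_]
  refine Submodule.mem_span_singleton.2 ⟨-α e, ?_⟩
  ext x
  simp [mul_comm]

lemma finrank_le_finrank_wedgeKernel_ι_mul_annForm [FiniteDimensional F V] (η : Dual F V) {k : ℕ}
    (Ω : ⋀[F]^(k + 1) (Submodule.dualAnnihilator (Submodule.span F {e}))) :
    finrank F V ≤
      finrank F (wedgeKernel (ι F η * (annForm Ω : ExteriorAlgebra F (Dual F V)))) +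
        kLength Ω * (finrank F V - (k + 2)) := by
  obtain ⟨v, hv⟩ := exists_eq_sum_kLength Ω
  have hsum : ι F η * (annForm Ω : ExteriorAlgebra F (Dual F V)) =
      ∑ i, ExteriorAlgebra.ιMulti F (k + 2) (Matrix.vecCons η fun j => (v i j : Dual F V)) := by
    conv_lhs => rw [hv]
    simp only [annForm, coe_exteriorPower_map, AddSubmonoidClass.coe_finsetSum, map_sum,
      exteriorPower.ιMulti_apply_coe, ExteriorAlgebra.map_apply_ιMulti, Finset.mul_sum]
    exact Finset.sum_congr rfl fun i _ => (ExteriorAlgebra.ιMulti_succ_apply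
      (Matrix.vecCons η fun j => (v i j : Dual F V))).symm
  rw [hsum, ← Subspace.dual_finrank_eq (K := F) (V := V)]
  exact finrank_le_finrank_wedgeKernel_sum _ _

lemma finrank_dualAnnihilator_span_singleton [FiniteDimensional F V] (he : e ≠ 0) :
    finrank F (Submodule.dualAnnihilator (Submodule.span F {e})) + 1 = finrank F V := by
  rw [← Subspace.finrank_add_finrank_dualAnnihilator_eq (Submodule.span F {e}),
    finrank_span_singleton he, add_comm]

lemma exists_annihilator_eq_smul_standardFour [NeZero (2 : F)] (hV : finrank F V = 7) (he : e ≠ 0)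
    (Ω : ⋀[F]^4 (Submodule.dualAnnihilator (Submodule.span F {e}))) :
    ∃ r ≤ 3, kLength Ω ≤ r ∧
      ∃ (f : Basis (Fin 6) F (Submodule.dualAnnihilator (Submodule.span F {e}))) (c : F),
        c ≠ 0 ∧ Ω = c • standardFour f r := by
  have : FiniteDimensional F V := FiniteDimensional.of_finrank_pos (by omega)
  have hW := finrank_dualAnnihilator_span_singleton (F := F) he
  obtain ⟨r, hr, f, c, hc, rfl⟩ := exists_eq_smul_standardFour (by omega) Ω
  exact ⟨r, hr, kLength_smul_standardFour_le c f r, f, c, hc, rfl⟩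

variable {ε : ℤˣ} (b : Basis (Fin 7) F V)

lemma two_le_kLength_annPart_starForm [NeZero (2 : F)] (h : η e = 1) :
    2 ≤ kLength (annPart h (starForm ε b)) := by
  have := Module.Finite.of_basis b
  have hη : η ≠ 0 := by rintro rfl; simp at h
  have hker := finrank_wedgeKernel_ι_mul_starForm_le_three (ε := ε) (b := b) hη
  have hle := finrank_le_finrank_wedgeKernel_ι_mul_annForm η (annPart h (starForm ε b))
  rw [ι_mul_annForm_annPart, finrank_eq_card_basis b, Fintype.card_fin] at hle
  omega

lemma kLength_annPart_starForm_eq_three [NeZero (2 : F)] (h : η e = 1)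
    (hη : metric ε b.dualBasis η η ≠ 0) : kLength (annPart h (starForm ε b)) = 3 := by
  have := Module.Finite.of_basis b
  have hV : finrank F V = 7 := by rw [finrank_eq_card_basis b, Fintype.card_fin]
  have he : e ≠ 0 := by rintro rfl; simp at h
  have hker := finrank_wedgeKernel_ι_mul_starForm_le_one hη
  have hle := finrank_le_finrank_wedgeKernel_ι_mul_annForm η (annPart h (starForm ε b))
  rw [ι_mul_annForm_annPart, hV] at hle
  obtain ⟨r, hr, hlength, -⟩ := exists_annihilator_eq_smul_standardFour hV he
    (annPart h (starForm ε b))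
  omega

end Length

/-! ### Four-forms on a hyperplane as Hodge duals -/

section Cobasis

variable {F V : Type*} [Field F] [AddCommGroup V] [Module F V] {e : V} {η : Dual F V}

lemma exists_basis_coord_eq {n : ℕ} [FiniteDimensional F V] (c : Basis (Fin n) F (Dual F V)) :
    ∃ b : Basis (Fin n) F V, b.coord = c := by
  refine ⟨c.dualBasis.map (evalEquiv F V).symm, funext fun i => ?_⟩
  refine (c.dualBasis.map (evalEquiv F V).symm).ext fun j => ?_
  rw [Basis.coord_apply, Basis.repr_self, Basis.map_apply, apply_evalEquiv_symm_apply,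
    Basis.coe_dualBasis, Basis.coord_apply, Basis.repr_self, Finsupp.single_apply,
    Finsupp.single_apply]
  simp only [eq_comm]

lemma exists_basis_coord_eq_of_mem_span (hV : finrank F V = 7) (h : η e = 1)
    (f : Basis (Fin 6) F (Submodule.dualAnnihilator (Submodule.span F {e})))
    {v : Fin 7 → Dual F V} (hη : η ∈ Submodule.span F (Set.range v))
    (hf : ∀ i, (f i : Dual F V) ∈ Submodule.span F (Set.range v)) :
    ∃ b : Basis (Fin 7) F V, b.coord = v := by
  have : FiniteDimensional F V := FiniteDimensional.of_finrank_pos (by omega)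
  have hspan : ⊤ ≤ Submodule.span F (Set.range v) := fun α _ => by
    have hα : α = (annProj h α : Dual F V) + α e • η := by simp [coe_annProj]
    rw [hα, ← f.sum_repr (annProj h α), Submodule.coe_sum]
    exact add_mem (sum_mem fun i _ => Submodule.smul_mem _ _ (hf i)) (Submodule.smul_mem _ _ hη)
  obtain ⟨b, hb⟩ := exists_basis_coord_eq
    (basisOfTopLeSpanOfCardEqFinrank v hspan (by simp [Subspace.dual_finrank_eq, hV]))
  exact ⟨b, by rw [hb, coe_basisOfTopLeSpanOfCardEqFinrank]⟩

lemma annProj_self (h : η e = 1) : annProj h η = 0 :=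
  Subtype.ext (by simp [coe_annProj, h])

lemma annProj_coe (h : η e = 1) (α : Submodule.dualAnnihilator (Submodule.span F {e})) :
    annProj h α = α := by
  have hα : (α : Dual F V) e = 0 :=
    (Submodule.mem_dualAnnihilator _).1 α.2 e (Submodule.mem_span_singleton_self e)
  exact Subtype.ext (by simp [coe_annProj, hα])

lemma annPart_starForm_eq_standardFour (h : η e = 1) {ε : ℤˣ} {b : Basis (Fin 7) F V}
    {f : Fin 6 → Submodule.dualAnnihilator (Submodule.span F {e})} {E : Fin 7 → WordSum 6}
    (hE : ∀ i, WordSum.eval F f (E i) = ι F (annProj h (b.coord i))) {r : ℕ}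
    (hr : WordSum.equiv ((starWords ε).subst E) (standardFourWords r) = true) :
    annPart h (starForm ε b) = standardFour f r := by
  refine Subtype.ext ?_
  rw [annPart, coe_exteriorPower_map, coe_starForm, WordSum.map_eval, coe_standardFour,
    ← WordSum.eval_eq_of_equiv F hr, WordSum.eval_subst F hE]
  rfl

/-- The expression of the adapted coframe of `exists_annPart_starForm_eq_standardFour_three` by the
given basis, modulo `η`. -/
def threeCoframe (ε : ℤˣ) : Fin 7 → WordSum 6 :=
  ![[(1, [0])], [(1, [1])], [(1, [2])], [(1, [3])], [(ε, [4])], [(1, [5])], []]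

lemma subst_threeCoframe (ε : ℤˣ) :
    WordSum.equiv ((starWords ε).subst (threeCoframe ε)) (standardFourWords 3) = true := by
  decide +kernel +revert

lemma exists_annPart_starForm_eq_standardFour_three (hV : finrank F V = 7) (h : η e = 1) (ε : ℤˣ)
    (f : Basis (Fin 6) F (Submodule.dualAnnihilator (Submodule.span F {e}))) :
    ∃ b : Basis (Fin 7) F V, b.coord 6 = η ∧ annPart h (starForm ε b) = standardFour f 3 := by
  let v : Fin 7 → Dual F V := ![f 0, f 1, f 2, f 3, (ε : ℤ) • (f 4 : Dual F V), f 5, η]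
  have hv (i) : v i ∈ Submodule.span F (Set.range v) := Submodule.subset_span ⟨i, rfl⟩
  have hf4 : (ε : ℤ) • v 4 = f 4 := by simp [v, smul_smul, Int.units_coe_mul_self]
  obtain ⟨b, hb⟩ := exists_basis_coord_eq_of_mem_span hV h f (hv 6) fun i => by
    fin_cases i
    exacts [hv 0, hv 1, hv 2, hv 3, hf4 ▸ zsmul_mem (hv 4) _, hv 5]
  refine ⟨b, by rw [hb]; rfl, annPart_starForm_eq_standardFour h (E := threeCoframe ε) ?_
    (subst_threeCoframe ε)⟩
  intro i
  rw [hb]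
  fin_cases i <;> simp [threeCoframe, v, annProj_self, annProj_coe]

/-- The expression of the adapted coframe of `exists_annPart_starForm_eq_standardFour_two` by the
given basis, modulo `η`. -/
def twoCoframe : Fin 7 → WordSum 6 :=
  ![[(1, [0])], [(1, [1])], [(1, [4]), (-1, [2])], [(1, [5]), (-1, [3])], [(1, [3])], [(1, [2])],
    [(-1, [0])]]

lemma subst_twoCoframe :
    WordSum.equiv ((starWords (-1)).subst twoCoframe) (standardFourWords 2) = true := by
  decide +kernel

lemma exists_annPart_starForm_eq_standardFour_two (hV : finrank F V = 7) (h : η e = 1)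
    (f : Basis (Fin 6) F (Submodule.dualAnnihilator (Submodule.span F {e}))) :
    ∃ b : Basis (Fin 7) F V, annPart h (starForm (-1) b) = standardFour f 2 := by
  let v : Fin 7 → Dual F V := ![f 0, f 1, (f 4 : Dual F V) - f 2, (f 5 : Dual F V) - f 3, f 3, f 2,
    η - f 0]
  have hv (i) : v i ∈ Submodule.span F (Set.range v) := Submodule.subset_span ⟨i, rfl⟩
  have hη : v 6 + v 0 = η := sub_add_cancel _ _
  have hf4 : v 2 + v 5 = f 4 := sub_add_cancel _ _
  have hf5 : v 3 + v 4 = f 5 := sub_add_cancel _ _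
  obtain ⟨b, hb⟩ := exists_basis_coord_eq_of_mem_span hV h f (hη ▸ add_mem (hv 6) (hv 0))
    fun i => by
      fin_cases i
      exacts [hv 0, hv 1, hv 5, hv 4, hf4 ▸ add_mem (hv 2) (hv 5), hf5 ▸ add_mem (hv 3) (hv 4)]
  refine ⟨b, annPart_starForm_eq_standardFour h (E := twoCoframe) ?_ subst_twoCoframe⟩
  intro i
  rw [hb]
  fin_cases i <;> simp [twoCoframe, v, annProj_self, annProj_coe, sub_eq_add_neg]

end Cobasis

/-! ### Non-degenerate hyperplanes -/

section Hyperplane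

variable {F V : Type*} [Field F] [AddCommGroup V] [Module F V]

lemma nondegenerate_restrict_ker_iff {B : LinearMap.BilinForm F V} (hB : B.Nondegenerate)
    (hsymm : B.IsSymm) {n : V} (hn : n ≠ 0) :
    (B.restrict (LinearMap.ker (B n))).Nondegenerate ↔ B n n ≠ 0 := by
  refine ⟨fun h hnn => hn ?_, fun h => ?_⟩
  · exact congrArg Subtype.val (h.1 ⟨n, hnn⟩ fun w => w.2)
  · have hker : LinearMap.ker (B n) = B.orthogonal (F ∙ n) :=
      (LinearMap.BilinForm.orthogonal_span_singleton_eq_toLin_ker n).symm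
    rw [hker]
    exact B.restrict_nondegenerate_orthogonal_spanSingleton hB hsymm.isRefl h

variable (ε : ℤˣ) (b : Basis (Fin 7) F V)

lemma metric_dualBasis_metric (v w : V) :
    metric ε b.dualBasis (metric ε b v) (metric ε b w) = metric ε b v w := by
  have hcoord (v : V) (i : Fin 7) :
      metric ε b v (b i) = ((metricSign ε i : ℤ) : F) * b.coord i v := by
    rw [← (metric_isSymm ε b).eq, metric_basis]
    rfl
  rw [metric_dualBasis_apply, metric_apply]
  simp only [hcoord]
  refine Finset.sum_congr rfl fun i _ => ?_
  linear_combination ((metricSign ε i : ℤ) : F) * b.coord i v * b.coord i w *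
    metricSign_mul_self (F := F) ε i

lemma nondegenerate_metric_restrict_ker_iff {η : Dual F V} (hη : η ≠ 0) :
    ((metric ε b).restrict (LinearMap.ker η)).Nondegenerate ↔ metric ε b.dualBasis η η ≠ 0 := by
  have := Module.Finite.of_basis b
  obtain ⟨n, rfl⟩ := (bijective_of_nondegenerate (metric_nondegenerate ε b)).2 η
  rw [metric_dualBasis_metric]
  exact nondegenerate_restrict_ker_iff (metric_nondegenerate ε b) (metric_isSymm ε b)
    fun hn => hη (by rw [hn, map_zero])

lemma metric_dualBasis_coord_self (i : Fin 7) :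
    metric ε b.dualBasis (b.coord i) (b.coord i) = ((metricSign ε i : ℤ) : F) := by
  simp [metric_dualBasis_apply, Finsupp.single_apply]

end Hyperplane

/-! ### Cocalibrated structures -/

section Structures

variable {F V : Type*} [Field F] [AddCommGroup V] [Module F V]

/-- `φ` is equal to `φ_ε` in some basis with volume form `vol`, and `g` is the bilinear form that
`φ` and `vol` induce. -/
structure IsModelStructure (ε : ℤˣ) (φ : Form F V 3) (vol : Form F V 7)
    (g : LinearMap.BilinForm F V) : Prop where
  adapted : ∃ b : Basis (Fin 7) F V, φ = phiForm ε b ∧ vol = volForm b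
  metric : IsInducedMetric φ vol g

lemma phiForm_one (b : Basis (Fin 7) F V) : phiForm 1 b = g2Form b := by
  simp [phiForm, g2Form]

lemma phiForm_neg_one (b : Basis (Fin 7) F V) : phiForm (-1) b = g2StarForm b := by
  simp [phiForm, g2StarForm, sub_eq_add_neg]

lemma isG2Structure_iff {V : Type*} [AddCommGroup V] [Module ℝ V] {φ : Form ℝ V 3}
    {vol : Form ℝ V 7} {g : LinearMap.BilinForm ℝ V} :
    IsG2Structure φ vol g ↔ IsModelStructure 1 φ vol g :=
  ⟨fun h => ⟨by simpa only [phiForm_one] using h.1, h.2⟩,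
    fun h => ⟨by simpa only [phiForm_one] using h.1, h.2⟩⟩

lemma isG2StarStructure_iff {V : Type*} [AddCommGroup V] [Module ℝ V] {φ : Form ℝ V 3}
    {vol : Form ℝ V 7} {g : LinearMap.BilinForm ℝ V} :
    IsG2StarStructure φ vol g ↔ IsModelStructure (-1) φ vol g :=
  ⟨fun h => ⟨by simpa only [phiForm_neg_one] using h.1, h.2⟩,
    fun h => ⟨by simpa only [phiForm_neg_one] using h.1, h.2⟩⟩

lemma isG2CStructure_iff {V : Type*} [AddCommGroup V] [Module ℂ V] {φ : Form ℂ V 3}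
    {vol : Form ℂ V 7} {g : LinearMap.BilinForm ℂ V} :
    IsG2CStructure φ vol g ↔ IsModelStructure 1 φ vol g :=
  ⟨fun h => ⟨by simpa only [phiForm_one] using h.1, h.2⟩,
    fun h => ⟨by simpa only [phiForm_one] using h.1, h.2⟩⟩

lemma exists_phiForm_neg_eq (hF : IsSquare (-1 : F)) (ε : ℤˣ) (b : Basis (Fin 7) F V) :
    ∃ b' : Basis (Fin 7) F V, phiForm (-ε) b' = phiForm ε b ∧ volForm b' = volForm b := by
  have := Module.Finite.of_basis b
  obtain ⟨I, hI⟩ := hF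
  have hI0 : I ≠ 0 := fun h => by simp [h] at hI
  let t : Fin 7 → F := ![I, I, I, I, -1, -1, 1]
  have ht (i) : IsUnit (t i) := isUnit_iff_ne_zero.2 (by fin_cases i <;> simp [t, hI0])
  obtain ⟨b', hb'⟩ := exists_basis_coord_eq (b.dualBasis.isUnitSMul ht)
  have hmono {k : ℕ} (i : Fin k → Fin 7) : mono b' i = (∏ j, t (i j)) • mono b i := by
    rw [mono, mono, ← AlternatingMap.map_smul_univ, hb']
    simp only [Basis.isUnitSMul_apply, Basis.coe_dualBasis]
  refine ⟨b', ?_, ?_⟩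
  · simp only [phiForm, hmono, Fin.prod_univ_three, t, Matrix.cons_val, ← hI, Units.val_neg]
    module
  · simp [volForm, hmono, Fin.prod_univ_seven, t, ← hI]

lemma IsModelStructure.neg (hF : IsSquare (-1 : F)) {ε : ℤˣ} {φ : Form F V 3} {vol : Form F V 7}
    {g : LinearMap.BilinForm F V} (h : IsModelStructure ε φ vol g) :
    IsModelStructure (-ε) φ vol g := by
  obtain ⟨⟨b, rfl, rfl⟩, hg⟩ := h
  obtain ⟨b', hφ, hvol⟩ := exists_phiForm_neg_eq hF ε b
  exact ⟨⟨b', hφ.symm, hvol.symm⟩, hg⟩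

lemma exists_isCocalibrated_iff {L : Type*} [LieRing L] [LieAlgebra F L] [NeZero (6 : F)] (ε : ℤˣ)
    (P : LinearMap.BilinForm F L → Prop) :
    (∃ (φ : Form F L 3) (vol : Form F L 7) (g : LinearMap.BilinForm F L),
      IsModelStructure ε φ vol g ∧ IsCocalibrated φ vol g ∧ P g) ↔
    ∃ b : Basis (Fin 7) F L, IsClosedForm (starForm ε b) ∧ P (metric ε b) := by
  constructor
  · rintro ⟨_, _, g, ⟨⟨b, rfl, rfl⟩, hg⟩, ⟨χ, hχ, hclosed⟩, hP⟩
    have := Module.Finite.of_basis b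
    obtain rfl := hg.unique (volForm_ne_zero b) (isInducedMetric_metric ε b)
    obtain rfl :=
      hχ.unique (volForm_ne_zero b) (metric_nondegenerate ε b) (isHodgeDual_starForm ε b)
    exact ⟨b, hclosed, hP⟩
  · rintro ⟨b, hclosed, hP⟩
    exact ⟨_, _, _, ⟨⟨b, rfl, rfl⟩, isInducedMetric_metric ε b⟩,
      ⟨_, isHodgeDual_starForm ε b, hclosed⟩, hP⟩

end Structures

section Ideal

variable {F L : Type*} [Field F] [LieRing L] [LieAlgebra F L]

lemma exists_isClosedForm_standardFour [NeZero (2 : F)] (hL : finrank F L = 7) {e : L} (he : e ≠ 0)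
    {Ω : ⋀[F]^4 (Submodule.dualAnnihilator (Submodule.span F {e}))}
    (hΩ : IsClosedForm (annForm Ω)) :
    ∃ r ≤ 3, kLength Ω ≤ r ∧
      ∃ f : Basis (Fin 6) F (Submodule.dualAnnihilator (Submodule.span F {e})),
        IsClosedForm (annForm (standardFour f r)) := by
  obtain ⟨r, hr, hlength, f, c, hc, rfl⟩ := exists_annihilator_eq_smul_standardFour hL he Ω
  refine ⟨r, hr, hlength, f, (isClosedForm_smul_iff hc _).1 ?_⟩
  rwa [annForm, map_smul] at hΩ

variable {U : LieIdeal F L} [IsLieAbelian U] {e : L} {η : Dual F L}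

lemma isClosedForm_annForm_annPart_iff_of_ker_eq (h : η e = 1)
    (hker : LinearMap.ker η = U.toSubmodule) (χ : Form F L (3 + 1)) :
    IsClosedForm (annForm (annPart h χ)) ↔ IsClosedForm χ :=
  isClosedForm_annForm_annPart_iff h (apply_ad_eq_zero h hker) (lie_eq_smul_ad_sub_smul_ad h hker) χ

lemma exists_isClosedForm_starForm_of_standardFour_three (hL : finrank F L = 7) (h : η e = 1)
    (hker : LinearMap.ker η = U.toSubmodule) (ε : ℤˣ)
    {f : Basis (Fin 6) F (Submodule.dualAnnihilator (Submodule.span F {e}))}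
    (hf : IsClosedForm (annForm (standardFour f 3))) :
    ∃ b : Basis (Fin 7) F L, IsClosedForm (starForm ε b) ∧ metric ε b.dualBasis η η ≠ 0 := by
  obtain ⟨b, hb, hstar⟩ := exists_annPart_starForm_eq_standardFour_three hL h ε f
  refine ⟨b, (isClosedForm_annForm_annPart_iff_of_ker_eq h hker _).1 (by rwa [hstar]), ?_⟩
  rw [← hb, metric_dualBasis_coord_self]
  exact left_ne_zero_of_mul_eq_one (metricSign_mul_self ε 6)

variable [NeZero (2 : F)]

lemma exists_isClosedForm_starForm_metric_ne_zero_iff (hL : finrank F L = 7) (h : η e = 1)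
    (hker : LinearMap.ker η = U.toSubmodule) (ε : ℤˣ) :
    (∃ b : Basis (Fin 7) F L, IsClosedForm (starForm ε b) ∧ metric ε b.dualBasis η η ≠ 0) ↔
      ∃ Ω : ⋀[F]^4 (Submodule.dualAnnihilator (Submodule.span F {e})),
        IsClosedForm (annForm Ω) ∧ kLength Ω = 3 := by
  constructor
  · rintro ⟨b, hb, hη⟩
    exact ⟨_, (isClosedForm_annForm_annPart_iff_of_ker_eq h hker _).2 hb,
      kLength_annPart_starForm_eq_three b h hη⟩
  · rintro ⟨Ω, hΩ, hlength⟩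
    obtain ⟨r, hr, hle, f, hf⟩ :=
      exists_isClosedForm_standardFour hL (fun he => by simp [he] at h) hΩ
    obtain rfl : r = 3 := by omega
    exact exists_isClosedForm_starForm_of_standardFour_three hL h hker ε hf

lemma exists_two_le_kLength_of_isClosedForm_starForm (h : η e = 1)
    (hker : LinearMap.ker η = U.toSubmodule) {ε : ℤˣ} {b : Basis (Fin 7) F L}
    (hb : IsClosedForm (starForm ε b)) :
    ∃ Ω : ⋀[F]^4 (Submodule.dualAnnihilator (Submodule.span F {e})),
      IsClosedForm (annForm Ω) ∧ 2 ≤ kLength Ω :=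
  ⟨_, (isClosedForm_annForm_annPart_iff_of_ker_eq h hker _).2 hb,
    two_le_kLength_annPart_starForm b h⟩

lemma exists_isClosedForm_starForm_neg_one_iff (hL : finrank F L = 7) (h : η e = 1)
    (hker : LinearMap.ker η = U.toSubmodule) :
    (∃ b : Basis (Fin 7) F L, IsClosedForm (starForm (-1) b)) ↔
      ∃ Ω : ⋀[F]^4 (Submodule.dualAnnihilator (Submodule.span F {e})),
        IsClosedForm (annForm Ω) ∧ 2 ≤ kLength Ω := by
  refine ⟨fun ⟨b, hb⟩ => exists_two_le_kLength_of_isClosedForm_starForm h hker hb, ?_⟩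
  rintro ⟨Ω, hΩ, hlength⟩
  obtain ⟨r, hr, hle, f, hf⟩ :=
    exists_isClosedForm_standardFour hL (fun he => by simp [he] at h) hΩ
  obtain rfl | rfl : r = 2 ∨ r = 3 := by omega
  · obtain ⟨b, hstar⟩ := exists_annPart_starForm_eq_standardFour_two hL h f
    exact ⟨b, (isClosedForm_annForm_annPart_iff_of_ker_eq h hker _).1 (by rwa [hstar])⟩
  · obtain ⟨b, hb, -⟩ := exists_isClosedForm_starForm_of_standardFour_three hL h hker (-1) hf
    exact ⟨b, hb⟩

end Ideal

section Classification

variable {F L : Type*} [Field F] [LieRing L] [LieAlgebra F L] {U : LieIdeal F L} {e : L}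

lemma exists_dual_ker_eq_of_finrank_eq (hL : finrank F L = 7) (hU : finrank F U = 6)
    (he : e ∉ U) : ∃ η : Dual F L, η e = 1 ∧ LinearMap.ker η = U.toSubmodule := by
  have := Module.finite_of_finrank_pos (hL ▸ Nat.succ_pos 6 : 0 < finrank F L)
  exact exists_dual_ker_eq_of_lieIdeal (by rw [hU, hL]) he

lemma exists_isModelStructure_neg_iff (hF : IsSquare (-1 : F)) (ε : ℤˣ) :
    (∃ (φ : Form F L 3) (vol : Form F L 7) (g : LinearMap.BilinForm F L),
      IsModelStructure (-ε) φ vol g ∧ IsCocalibrated φ vol g) ↔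
    ∃ (φ : Form F L 3) (vol : Form F L 7) (g : LinearMap.BilinForm F L),
      IsModelStructure ε φ vol g ∧ IsCocalibrated φ vol g := by
  have hneg (φ : Form F L 3) (vol : Form F L 7) (g : LinearMap.BilinForm F L) :
      IsModelStructure (-ε) φ vol g ↔ IsModelStructure ε φ vol g :=
    ⟨fun h => by simpa only [neg_neg] using h.neg hF, fun h => h.neg hF⟩
  simp only [hneg]

variable [NeZero (6 : F)] [IsLieAbelian U]

lemma neZero_two_of_neZero_six : NeZero (2 : F) :=
  ⟨fun h => NeZero.ne (6 : F) (by linear_combination 3 * h)⟩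

lemma exists_isCocalibrated_nondegenerate_iff (hL : finrank F L = 7) (hU : finrank F U = 6)
    (he : e ∉ U) (ε : ℤˣ) :
    (∃ (φ : Form F L 3) (vol : Form F L 7) (g : LinearMap.BilinForm F L),
      IsModelStructure ε φ vol g ∧ IsCocalibrated φ vol g ∧
        (g.restrict U.toSubmodule).Nondegenerate) ↔
      ∃ Ω : ⋀[F]^4 (Submodule.dualAnnihilator (Submodule.span F {e})),
        IsClosedForm (annForm Ω) ∧ kLength Ω = 3 := by
  have := neZero_two_of_neZero_six (F := F)
  obtain ⟨η, h, hker⟩ := exists_dual_ker_eq_of_finrank_eq hL hU he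
  have hη : η ≠ 0 := fun h0 => by simp [h0] at h
  rw [exists_isCocalibrated_iff ε fun g => (g.restrict U.toSubmodule).Nondegenerate, ← hker,
    ← exists_isClosedForm_starForm_metric_ne_zero_iff hL h hker ε]
  simp only [nondegenerate_metric_restrict_ker_iff ε _ hη]

lemma exists_isCocalibrated_neg_one_iff (hL : finrank F L = 7) (hU : finrank F U = 6)
    (he : e ∉ U) :
    (∃ (φ : Form F L 3) (vol : Form F L 7) (g : LinearMap.BilinForm F L),
      IsModelStructure (-1) φ vol g ∧ IsCocalibrated φ vol g) ↔
      ∃ Ω : ⋀[F]^4 (Submodule.dualAnnihilator (Submodule.span F {e})),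
        IsClosedForm (annForm Ω) ∧ 2 ≤ kLength Ω := by
  have := neZero_two_of_neZero_six (F := F)
  obtain ⟨η, h, hker⟩ := exists_dual_ker_eq_of_finrank_eq hL hU he
  rw [← exists_isClosedForm_starForm_neg_one_iff hL h hker]
  simpa only [and_true] using exists_isCocalibrated_iff (F := F) (L := L) (-1) fun _ => True

lemma exists_isCocalibrated_one_iff_of_anisotropic
    (hF : ∀ n : Fin 7 → F, n ⬝ᵥ n = 0 → n = 0) (hL : finrank F L = 7)
    (hU : finrank F U = 6) (he : e ∉ U) :
    (∃ (φ : Form F L 3) (vol : Form F L 7) (g : LinearMap.BilinForm F L),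
      IsModelStructure 1 φ vol g ∧ IsCocalibrated φ vol g) ↔
      ∃ Ω : ⋀[F]^4 (Submodule.dualAnnihilator (Submodule.span F {e})),
        IsClosedForm (annForm Ω) ∧ kLength Ω = 3 := by
  have := neZero_two_of_neZero_six (F := F)
  obtain ⟨η, h, hker⟩ := exists_dual_ker_eq_of_finrank_eq hL hU he
  have hη (b : Basis (Fin 7) F L) : metric 1 b.dualBasis η η ≠ 0 := fun h0 => by
    have hzero : (fun i => η (b i)) = 0 := hF _ (by
      simpa [metric_dualBasis_apply, metricSign, dotProduct] using h0)
    have hη0 : η = 0 := b.ext fun i => congrFun hzero i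
    simp [hη0] at h
  rw [← exists_isClosedForm_starForm_metric_ne_zero_iff hL h hker 1]
  simpa only [and_true, hη, ne_eq, not_false_eq_true] using
    exists_isCocalibrated_iff (F := F) (L := L) 1 fun _ => True

end Classification

end CocalibratedG2

open CocalibratedG2 Module in
theorem mainTheorem7_general {F L : Type*} [Field F] [NeZero (6 : F)] [LieRing L] [LieAlgebra F L]
    (hL : finrank F L = 7) (U : LieIdeal F L) [IsLieAbelian U] (hU : finrank F U = 6) {e : L}
    (he : e ∉ U) :
    (∀ ε : ℤˣ,
      (∃ (φ : Form F L 3) (vol : Form F L 7) (g : LinearMap.BilinForm F L),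
        IsModelStructure ε φ vol g ∧ IsCocalibrated φ vol g ∧
          (g.restrict U.toSubmodule).Nondegenerate) ↔
      ∃ Ω : ⋀[F]^4 (Submodule.dualAnnihilator (Submodule.span F {e})),
        IsClosedForm (annForm Ω) ∧ kLength Ω = 3) ∧
    ((∃ (φ : Form F L 3) (vol : Form F L 7) (g : LinearMap.BilinForm F L),
        IsModelStructure (-1) φ vol g ∧ IsCocalibrated φ vol g) ↔
      ∃ Ω : ⋀[F]^4 (Submodule.dualAnnihilator (Submodule.span F {e})),
        IsClosedForm (annForm Ω) ∧ 2 ≤ kLength Ω) ∧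
    ((∀ n : Fin 7 → F, n ⬝ᵥ n = 0 → n = 0) →
      ((∃ (φ : Form F L 3) (vol : Form F L 7) (g : LinearMap.BilinForm F L),
        IsModelStructure 1 φ vol g ∧ IsCocalibrated φ vol g) ↔
      ∃ Ω : ⋀[F]^4 (Submodule.dualAnnihilator (Submodule.span F {e})),
        IsClosedForm (annForm Ω) ∧ kLength Ω = 3)) ∧
    (IsSquare (-1 : F) →
      ((∃ (φ : Form F L 3) (vol : Form F L 7) (g : LinearMap.BilinForm F L),
        IsModelStructure 1 φ vol g ∧ IsCocalibrated φ vol g) ↔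
      ∃ Ω : ⋀[F]^4 (Submodule.dualAnnihilator (Submodule.span F {e})),
        IsClosedForm (annForm Ω) ∧ 2 ≤ kLength Ω)) :=
  ⟨exists_isCocalibrated_nondegenerate_iff hL hU he, exists_isCocalibrated_neg_one_iff hL hU he,
    fun hF => exists_isCocalibrated_one_iff_of_anisotropic hF hL hU he,
    fun hF => (exists_isModelStructure_neg_iff hF 1).symm.trans
      (exists_isCocalibrated_neg_one_iff hL hU he)⟩

open CocalibratedG2 in
theorem mainTheorem7 :
    -- the real case
    (∀ (L : Type*) [LieRing L] [LieAlgebra ℝ L] (_ : Module.finrank ℝ L = 7)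
      (U : LieIdeal ℝ L) [IsLieAbelian U] (_ : Module.finrank ℝ U = 6) (e : L) (_ : e ∉ U),
      -- cocalibrated G₂-structures
      ((∃ (φ : Form ℝ L 3) (vol : Form ℝ L 7) (g : LinearMap.BilinForm ℝ L),
          IsG2Structure φ vol g ∧ IsCocalibrated φ vol g) ↔
        ∃ Ω : ⋀[ℝ]^4 (Submodule.dualAnnihilator (Submodule.span ℝ {e})),
          IsClosedForm (annForm Ω) ∧ kLength Ω = 3) ∧
      -- cocalibrated G₂*-structures for which the ideal is non-degenerate
      ((∃ Ω : ⋀[ℝ]^4 (Submodule.dualAnnihilator (Submodule.span ℝ {e})),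
          IsClosedForm (annForm Ω) ∧ kLength Ω = 3) ↔
        ∃ (φ : Form ℝ L 3) (vol : Form ℝ L 7) (g : LinearMap.BilinForm ℝ L),
          IsG2StarStructure φ vol g ∧ IsCocalibrated φ vol g ∧
            (g.restrict U.toSubmodule).Nondegenerate) ∧
      -- cocalibrated G₂*-structures
      ((∃ (φ : Form ℝ L 3) (vol : Form ℝ L 7) (g : LinearMap.BilinForm ℝ L),
          IsG2StarStructure φ vol g ∧ IsCocalibrated φ vol g) ↔
        ∃ Ω : ⋀[ℝ]^4 (Submodule.dualAnnihilator (Submodule.span ℝ {e})),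
          IsClosedForm (annForm Ω) ∧ 2 ≤ kLength Ω)) ∧
    -- the complex case
    (∀ (L : Type*) [LieRing L] [LieAlgebra ℂ L] (_ : Module.finrank ℂ L = 7)
      (U : LieIdeal ℂ L) [IsLieAbelian U] (_ : Module.finrank ℂ U = 6) (e : L) (_ : e ∉ U),
      -- cocalibrated (G₂)_ℂ-structures
      ((∃ (φ : Form ℂ L 3) (vol : Form ℂ L 7) (g : LinearMap.BilinForm ℂ L),
          IsG2CStructure φ vol g ∧ IsCocalibrated φ vol g) ↔
        ∃ Ω : ⋀[ℂ]^4 (Submodule.dualAnnihilator (Submodule.span ℂ {e})),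
          IsClosedForm (annForm Ω) ∧ 2 ≤ kLength Ω) ∧
      -- cocalibrated (G₂)_ℂ-structures for which the ideal is non-degenerate
      ((∃ (φ : Form ℂ L 3) (vol : Form ℂ L 7) (g : LinearMap.BilinForm ℂ L),
          IsG2CStructure φ vol g ∧ IsCocalibrated φ vol g ∧
            (g.restrict U.toSubmodule).Nondegenerate) ↔
        ∃ Ω : ⋀[ℂ]^4 (Submodule.dualAnnihilator (Submodule.span ℂ {e})),
          IsClosedForm (annForm Ω) ∧ kLength Ω = 3)) := by
  constructor
  · intro L _ _ hL U _ hU e he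
    have : NeZero (6 : ℝ) := ⟨by norm_num⟩
    obtain ⟨hnondeg, hneg, hpos, -⟩ := mainTheorem7_general hL U hU he
    simp only [isG2Structure_iff, isG2StarStructure_iff]
    exact ⟨hpos fun _ => dotProduct_self_eq_zero.1, (hnondeg (-1)).symm, hneg⟩
  · intro L _ _ hL U _ hU e he
    have : NeZero (6 : ℂ) := ⟨by norm_num⟩
    obtain ⟨hnondeg, -, -, hpos⟩ := mainTheorem7_general hL U hU he
    simp only [isG2CStructure_iff]
    exact ⟨hpos ⟨Complex.I, Complex.I_mul_I.symm⟩, hnondeg 1⟩
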